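/- Consider a network of single-antenna full-duplex base stations (BSs) in the plane, each serving one half-duplex uplink (UL) node with a single antenna and one half-duplex downlink (DL) node with two receive antennas. The typical BS is at the origin; the other BSs form a homogeneous Poisson point process $\Phi$ of density $\lambda>0$. The UL and DL nodes of the BS at $x$ are $\widetilde m_x=x+\widetilde R(\cos\widetilde\varphi_x,\sin\widetilde\varphi_x)$ and $\widehat m_x=x+\widehat R(\cos\widehat\varphi_x,\sin\widehat\varphi_x)$, with all angles independent and uniform on $[0,2\pi]$. UL nodes and BSs transmit with powers $\widetilde\rho>0$ and $\widehat\rho>0$; the path loss between $x$ and $z$ is $\|x-z\|^{-\alpha}$ with $\alpha>2$; all channel vectors $\mathbf h_{y}\in\mathbb C^2$ from a transmitter $y$ to the typical DL node $\widehat m_0$ have i.i.d. $\mathcal{CN}(0,1)$ entries. The point process, the angles and the channels are independent. If the typical DL node uses the unit receive combining vector $\mathbf v$, its signal-to-interference ratio is $$\mathrm{SIR}(\mathbf v)=\frac{\widehat\rho\,\widehat R^{-\alpha}|\mathbf v^{\mathrm H}\mathbf h_0|^2}{\sum_{x\in\Phi}\big(\widehat\rho\|x-\widehat m_0\|^{-\alpha}|\mathbf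 v^{\mathrm H}\mathbf h_x|^2+\widetilde\rho\|\widetilde m_x-\widehat m_0\|^{-\alpha}|\mathbf v^{\mathrm H}\mathbf h_{\widetilde m_x}|^2\big)+\widetilde\rho\|\widetilde m_0-\widehat m_0\|^{-\alpha}|\mathbf v^{\mathrm H}\mathbf h_{\widetilde m_0}|^2}.$$ Maximum ratio combining (MRC) uses $\mathbf v_{\mathrm{MRC}}=\mathbf h_0/\|\mathbf h_0\|$. Partial zero forcing (PZF) uses one antenna to cancel the intra-cell interference from $\widetilde m_0$: $\mathbf v_{\mathrm{PZF}}$ is the normalized orthogonal projection of $\mathbf h_0$ onto the orthogonal complement of $\mathbf h_{\widetilde m_0}$. Let $\widetilde R=\widehat R=R>0$ and $\theta>0$. If $R\le \Delta(\theta)/\sqrt\lambda$, where $$\Delta(\theta)=\theta^{1-\frac1\alpha}\,\widetilde\rho\,\widehat\rho^{\frac1\alpha-1}\sqrt{\frac{2^{-(2\alpha+1)}\alpha}{\Upsilon^{(\min)}(1)\,\big(2^{-\alpha}\theta\widetilde\rho\widehat\rho^{-1}+1\big)}},\qquad \Upsilon^{(\min)}(s)=\Big(1+\frac2\alpha\Big)\big(\widetilde\rho^{\frac2\alpha}+\widehat\rho^{\frac2\alpha}\big)\frac{\pi^2s^{\frac2\alpha}}{\alpha\sin(2\pi/\alpha)},$$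 then cancelling the intra-cell UL interference improves the success probability of the second hop: $$\Pr[\mathrm{SIR}(\mathbf v_{\mathrm{PZF}})>\theta]>\Pr[\mathrm{SIR}(\mathbf v_{\mathrm{MRC}})>\theta].$$ -/

import Mathlib

open MeasureTheory ProbabilityTheory

namespace FDNetwork

noncomputable section

/-- The Euclidean plane in which the nodes are located. -/
abbrev Plane : Type := EuclideanSpace ℝ (Fin 2)

/-- Channel vectors from a single-antenna transmitter to a receiver with two antennas. -/
abbrev Channel : Type := EuclideanSpace ℂ (Fin 2)

/-! ### Laws of the random ingredients -/

/-- The circularly symmetric complex Gaussian law `CN(0, 1)`: independent real and imaginary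
parts, each normal with mean `0` and variance `1 / 2`. -/
def complexNormal : Measure ℂ :=
  ((gaussianReal 0 (1 / 2)).prod (gaussianReal 0 (1 / 2))).map fun p : ℝ × ℝ => ⟨p.1, p.2⟩

/-- Rayleigh fading: the two entries of the channel vector are i.i.d. `CN(0, 1)`. -/
def rayleigh : Measure Channel :=
  (Measure.pi fun _ : Fin 2 => complexNormal).map (WithLp.toLp 2)

/-- The uniform law on `[0, 2π]`. -/
def uniformAngle : Measure ℝ := volume[|Set.Icc 0 (2 * Real.pi)]

/-- The random elements attached to one cell (one FD BS with its UL and DL nodes). -/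
abbrev CellMark : Type := (ℝ × ℝ) × (Channel × Channel)

/-- Direction of the UL node of the cell, seen from its BS. -/
def CellMark.ulAngle (m : CellMark) : ℝ := m.1.1

/-- Direction of the DL node of the cell, seen from its BS. -/
def CellMark.dlAngle (m : CellMark) : ℝ := m.1.2

/-- Channel from the BS of the cell to the typical DL node. -/
def CellMark.bsChannel (m : CellMark) : Channel := m.2.1

/-- Channel from the UL node of the cell to the typical DL node. -/
def CellMark.ulChannel (m : CellMark) : Channel := m.2.2

/-- Law of the mark of a cell: independent uniform angles and independent Rayleigh channels. -/
def cellLaw : Measure CellMark :=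
  (uniformAngle.prod uniformAngle).prod (rayleigh.prod rayleigh)

/-- `X 0, X 1, …` enumerate the points of a Poisson point process with intensity measure `μ`:
the number of points in a measurable set of finite measure is Poisson distributed, and the
numbers of points in pairwise disjoint measurable sets are independent. -/
structure IsPoissonPointProcess {Ω E : Type*} [MeasurableSpace Ω] [MeasurableSpace E]
    (P : Measure Ω) (μ : Measure E) (X : ℕ → Ω → E) : Prop where
  measurable : ∀ i, Measurable (X i)
  count_law : ∀ B : Set E, MeasurableSet B → μ B ≠ ⊤ →
    HasLaw (fun ω => Measure.sum (fun i => Measure.dirac (X i ω)) B)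
      ((poissonMeasure (μ B).toNNReal).map fun n : ℕ => (n : ENNReal)) P
  indep : ∀ (n : ℕ) (B : Fin n → Set E), (∀ j, MeasurableSet (B j)) →
    Pairwise (fun j k => Disjoint (B j) (B k)) →
    iIndepFun (fun j ω => Measure.sum (fun i => Measure.dirac (X i ω)) (B j)) P

/-- The random network seen from the typical cell. The typical BS sits at the origin; `X i` is
the location of the `i`-th other BS. The cells are indexed by `Option ℕ`: `none` is the typical
cell and `some i` is the cell of the BS at `X i`. The BSs form a homogeneous Poisson point
process of density `lam`, independently marked by the i.i.d. cell marks. -/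
structure IsNetwork {Ω : Type*} [MeasurableSpace Ω] (P : Measure Ω) (lam : ℝ)
    (X : ℕ → Ω → Plane) (mark : Option ℕ → Ω → CellMark) : Prop where
  poisson : IsPoissonPointProcess P (ENNReal.ofReal lam • (volume : Measure Plane)) X
  mark_measurable : ∀ c, Measurable (mark c)
  mark_law : ∀ c, HasLaw (mark c) cellLaw P
  mark_indep : iIndepFun mark P
  indep : IndepFun (fun ω i => X i ω) (fun ω c => mark c ω) P

/-! ### Geometry and path loss -/

/-- The point at distance `r` from `x` in the direction `φ`. -/
def pointAt (x : Plane) (r φ : ℝ) : Plane := x + r • !₂[Real.cos φ, Real.sin φ]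

/-- The path loss `‖x - z‖ ^ (-α)`, infinite when `x = z`. -/
def pathLoss (α : ℝ) (x z : Plane) : ENNReal := edist x z ^ (-α)

/-! ### Receive combining at the typical DL node -/

/-- Maximum ratio combining for the desired channel `h`. -/
def mrc (h : Channel) : Channel := ((‖h‖⁻¹ : ℝ) : ℂ) • h

/-- Partial zero forcing: spend one antenna on cancelling the channel `q`, i.e. project the
desired channel `h` onto the orthogonal complement of `q` and normalize. -/
def pzf (q h : Channel) : Channel :=
  ((‖(Submodule.span ℂ {q})ᗮ.starProjection h‖⁻¹ : ℝ) : ℂ) •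
    (Submodule.span ℂ {q})ᗮ.starProjection h

/-- The received power factor `|v^H h|²`. -/
def gain (v h : Channel) : ENNReal := ENNReal.ofReal (‖inner ℂ v h‖ ^ 2)

/-! ### Interference, SIR and success probability of the second hop -/

/-- Overall interference power at the typical DL node with combining vector `v`, for a network
realization with BS locations `x` and cell marks `m`. Here `rhoU`, `rhoB` are the transmit powers
of UL nodes and BSs and `RU`, `RD` are the UL and DL link distances. The last summand is the
intra-cell interference from the UL node of the typical cell. (The single-antenna BSs transmit
with weights of modulus one, which do not affect the powers.) -/
def interference (α rhoU rhoB RU RD : ℝ) (x : ℕ → Plane) (m : Option ℕ → CellMark)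
    (v : Channel) : ENNReal :=
  let z := pointAt 0 RD (m none).dlAngle
  (∑' i, (ENNReal.ofReal rhoB * pathLoss α (x i) z * gain v (m (some i)).bsChannel
      + ENNReal.ofReal rhoU * pathLoss α (pointAt (x i) RU (m (some i)).ulAngle) z
        * gain v (m (some i)).ulChannel))
    + ENNReal.ofReal rhoU * pathLoss α (pointAt 0 RU (m none).ulAngle) z
        * gain v (m none).ulChannel

/-- Signal-to-interference ratio at the typical DL node with combining vector `v`. -/
def sir (α rhoU rhoB RU RD : ℝ) (x : ℕ → Plane) (m : Option ℕ → CellMark)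
    (v : Channel) : ENNReal :=
  ENNReal.ofReal rhoB * ENNReal.ofReal (RD ^ (-α)) * gain v (m none).bsChannel
    / interference α rhoU rhoB RU RD x m v

/-- Success probability of the second hop when the typical DL node uses both antennas to enhance
the desired signal (MRC). -/
def successMRC {Ω : Type*} [MeasurableSpace Ω] (P : Measure Ω)
    (X : ℕ → Ω → Plane) (mark : Option ℕ → Ω → CellMark) (α rhoU rhoB RU RD θ : ℝ) : ENNReal :=
  P {ω | ENNReal.ofReal θ < sir α rhoU rhoB RU RD (fun i => X i ω) (fun c => mark c ω)
    (mrc (mark none ω).bsChannel)}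

/-- Success probability of the second hop when the typical DL node uses one antenna to cancel the
interference from the UL node of its own cell (PZF). -/
def successPZF {Ω : Type*} [MeasurableSpace Ω] (P : Measure Ω)
    (X : ℕ → Ω → Plane) (mark : Option ℕ → Ω → CellMark) (α rhoU rhoB RU RD θ : ℝ) : ENNReal :=
  P {ω | ENNReal.ofReal θ < sir α rhoU rhoB RU RD (fun i => X i ω) (fun c => mark c ω)
    (pzf (mark none ω).ulChannel (mark none ω).bsChannel)}

/-! ### The threshold -/

/-- `Υ^(min)(s)`. -/
def upsilonMin (α rhoU rhoB s : ℝ) : ℝ :=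
  (1 + 2 / α) * (rhoU ^ (2 / α) + rhoB ^ (2 / α)) *
    (Real.pi ^ 2 * s ^ (2 / α) / (α * Real.sin (2 * Real.pi / α)))

/-- `Δ(θ)`. -/
def delta (α rhoU rhoB θ : ℝ) : ℝ :=
  θ ^ (1 - 1 / α) * rhoU * rhoB ^ (1 / α - 1) *
    Real.sqrt ((2 : ℝ) ^ (-(2 * α + 1)) * α /
      (upsilonMin α rhoU rhoB 1 * ((2 : ℝ) ^ (-α) * θ * rhoU * rhoB⁻¹ + 1)))

end

end FDNetwork

/-! Put τ = θ / (ρ̂ R^(-α)) and let I be the inter-cell interference. Both combiners are unit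
vectors built from the typical cell's channels alone, so the fading powers seen from other cells are
i.i.d. mean-one exponentials, independent of those channels (`IsNetwork.success_eq`). Given I and
the angles, PZF has an exponential signal gain and no intra-cell interference, so it succeeds with
probability exp(-τI). Under MRC the signal gain is Gamma(2), with tail (1 + t) exp(-t), evaluated at
t = τI + u e, where e is exponential and u is τ times the unfaded intra-cell power.

Let L = E exp(-τI), which is the PZF success probability, and p = 1 / (1 + u). Averaging the MRC
tail over e and I, given the angles, yields L (2p - p²) + p E[τI exp(-τI)]. The last expectation is
at most L T, where T is λ times the plane integrals of A / (1 + A)² for A = τρ̂‖x‖^(-α) and A =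
τρ̃‖x‖^(-α) (`lintegral_mul_expNeg_interCell_le`). This is a bound on the derivative of the Laplace
transform, obtained from difference quotients. Hence the conditional MRC probability is at most L
((2 + T) p - p²).

It remains to average over the angles. Let y in [0, 1] be the squared UL-DL distance divided by
(2R)². Since α > 2, u ≥ a / y with a = 2^(-α) θ ρ̃ / ρ̂, so p ≤ y / (y + a). The resulting bound is
concave in y and lies below its tangent at y = 1/2, the mean of y (`le_tangent`,
`lintegral_tangent_sqChord`). The value at 1/2 is less than 1 as soon as T < 2a² / (1 + a), and the
assumption on R gives exactly this (`interConst_lt`). As L > 0, the comparison is strict. -/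

namespace FDNetwork

open Filter Topology

/-! ### Exponential and logarithm on [0, ∞]: interference may be infinite -/

/-- The function `exp (-t)` on `[0, ∞]`, with value `0` at `∞`. -/
noncomputable def expNeg (t : ENNReal) : ENNReal := EReal.exp (-(t : EReal))

lemma expNeg_zero : expNeg 0 = 1 := by simp [expNeg]

lemma expNeg_top : expNeg ⊤ = 0 := by simp [expNeg]

lemma expNeg_ofReal {x : ℝ} (hx : 0 ≤ x) :
    expNeg (ENNReal.ofReal x) = ENNReal.ofReal (Real.exp (-x)) := by
  rw [expNeg, EReal.coe_ennreal_ofReal, max_eq_left hx, ← EReal.coe_neg, EReal.exp_coe]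

lemma expNeg_add (a b : ENNReal) : expNeg (a + b) = expNeg a * expNeg b := by
  rw [expNeg, EReal.coe_ennreal_add, EReal.neg_add, sub_eq_add_neg, EReal.exp_add]
  · rfl
  · simp
  · simp

lemma antitone_expNeg : Antitone expNeg := fun a b h => by
  simpa [expNeg] using h

lemma expNeg_le_one (a : ENNReal) : expNeg a ≤ 1 :=
  expNeg_zero ▸ antitone_expNeg zero_le

lemma expNeg_ne_top (a : ENNReal) : expNeg a ≠ ⊤ :=
  ((expNeg_le_one a).trans_lt ENNReal.one_lt_top).ne

lemma expNeg_ne_zero {a : ENNReal} (ha : a ≠ ⊤) : expNeg a ≠ 0 := by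
  simpa [expNeg] using ha

lemma continuous_expNeg : Continuous expNeg :=
  ENNReal.continuous_exp.comp (continuous_neg.comp continuous_coe_ennreal_ereal)

@[fun_prop]
lemma measurable_expNeg : Measurable expNeg := continuous_expNeg.measurable

lemma expNeg_mul_natCast (a : ENNReal) (n : ℕ) : expNeg (a * n) = expNeg a ^ n := by
  induction n with
  | zero => simp [expNeg_zero]
  | succ n ih => rw [Nat.cast_succ, mul_add, mul_one, expNeg_add, ih, pow_succ]

lemma expNeg_sum {ι : Type*} (s : Finset ι) (f : ι → ENNReal) :
    expNeg (∑ i ∈ s, f i) = ∏ i ∈ s, expNeg (f i) := by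
  classical
  induction s using Finset.induction_on with
  | empty => simp [expNeg_zero]
  | insert a s ha ih => rw [Finset.sum_insert ha, Finset.prod_insert ha, expNeg_add, ih]

lemma tendsto_prod_expNeg (f : ℕ → ENNReal) :
    Tendsto (fun n => ∏ i ∈ Finset.range n, expNeg (f i)) atTop (𝓝 (expNeg (∑' i, f i))) := by
  simp_rw [← expNeg_sum]
  exact (continuous_expNeg.tendsto _).comp (ENNReal.tendsto_nat_tsum f)

/-- The inverse of `expNeg` on `[0, 1]`. -/
noncomputable def negLog (p : ENNReal) : ENNReal := (-(ENNReal.log p)).toENNReal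

lemma expNeg_negLog {p : ENNReal} (hp : p ≤ 1) : expNeg (negLog p) = p := by
  have h : 0 ≤ -(ENNReal.log p) := by
    rw [EReal.le_neg, neg_zero]
    simpa using hp
  rw [expNeg, negLog, EReal.coe_toENNReal h, neg_neg, ENNReal.exp_log]

@[fun_prop]
lemma measurable_negLog : Measurable negLog := by
  have := ENNReal.measurable_log
  unfold negLog
  fun_prop

/-! ### Laplace functional of a Poisson point process -/

/-- The probability generating function of a Poisson variable, evaluated at `expNeg c`. With c = ∞
it is the void probability. -/
lemma lintegral_expNeg_poissonMeasure (c : ENNReal) (r : NNReal) :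
    ∫⁻ n, expNeg (c * n) ∂(poissonMeasure r) = expNeg (r * (1 - expNeg c)) := by
  obtain ⟨p, hp0, hp⟩ : ∃ p : ℝ, 0 ≤ p ∧ expNeg c = ENNReal.ofReal p :=
    ⟨(expNeg c).toReal, ENNReal.toReal_nonneg, (ENNReal.ofReal_toReal (expNeg_ne_top c)).symm⟩
  have hp1 : p ≤ 1 := by
    have := expNeg_le_one c
    rwa [hp, ENNReal.ofReal_le_one] at this
  rw [lintegral_countable']
  simp_rw [expNeg_mul_natCast, hp, poissonMeasure_singleton]
  have h1 : (r : ENNReal) * (1 - ENNReal.ofReal p) = ENNReal.ofReal (r * (1 - p)) := by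
    rw [ENNReal.ofReal_mul r.coe_nonneg, ENNReal.ofReal_coe_nnreal, ENNReal.ofReal_sub _ hp0,
      ENNReal.ofReal_one]
  rw [h1, expNeg_ofReal (mul_nonneg r.coe_nonneg (by linarith))]
  have h2 : HasSum (fun n : ℕ => Real.exp (-r) * ((r * p) ^ n / (n.factorial : ℝ)))
      (Real.exp (-r) * Real.exp (r * p)) := by
    have := (NormedSpace.expSeries_div_hasSum_exp ((r : ℝ) * p)).mul_left (Real.exp (-r))
    rwa [← Real.exp_eq_exp_ℝ] at this
  rw [← Real.exp_add] at h2
  have h3 : -(r : ℝ) + r * p = -(r * (1 - p)) := by ring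
  rw [h3] at h2
  rw [← h2.tsum_eq, ENNReal.ofReal_tsum_of_nonneg (fun n => by positivity) h2.summable]
  refine tsum_congr fun n => ?_
  rw [← ENNReal.ofReal_pow hp0, ← ENNReal.ofReal_mul (by positivity)]
  congr 1
  rw [mul_pow]
  ring

lemma tsum_comp_eq_lintegral_counting {Ω E : Type*} [MeasurableSpace E] {X : ℕ → Ω → E}
    {f : E → ENNReal} (hf : Measurable f) (ω : Ω) :
    ∑' i, f (X i ω) = ∫⁻ x, f x ∂(Measure.sum fun i => Measure.dirac (X i ω)) := by
  rw [lintegral_sum_measure]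
  exact tsum_congr fun i => (lintegral_dirac' _ hf).symm

variable {Ω E : Type*} [MeasurableSpace Ω] [MeasurableSpace E] {P : Measure Ω} {μ : Measure E}
  {X : ℕ → Ω → E}

lemma IsPoissonPointProcess.measurable_count (h : IsPoissonPointProcess P μ X) {B : Set E}
    (hB : MeasurableSet B) :
    Measurable fun ω => Measure.sum (fun i => Measure.dirac (X i ω)) B := by
  have := h.measurable
  simp_rw [Measure.sum_apply _ hB, Measure.dirac_apply' _ hB]
  exact Measurable.tsum fun i => (measurable_one.indicator hB).comp (this i)

lemma IsPoissonPointProcess.lintegral_expNeg_count (h : IsPoissonPointProcess P μ X) {B : Set E}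
    (hB : MeasurableSet B) (hμ : μ B ≠ ⊤) (c : ENNReal) :
    ∫⁻ ω, expNeg (c * Measure.sum (fun i => Measure.dirac (X i ω)) B) ∂P
      = expNeg (μ B * (1 - expNeg c)) := by
  have h1 := (h.count_law B hB hμ).map_eq
  have h2 : ∫⁻ n, expNeg (c * n) ∂(P.map fun ω =>
      Measure.sum (fun i => Measure.dirac (X i ω)) B) = _ :=
    lintegral_map (by fun_prop) (h.measurable_count hB)
  rw [← h2, h1, lintegral_map (by fun_prop) .of_discrete, lintegral_expNeg_poissonMeasure,
    ENNReal.coe_toNNReal hμ]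

/-- The sum over the points is a combination of the counts in the disjoint level sets, which are
independent, so the Laplace functional factors. The level set of 0 contributes nothing and may have
infinite measure. -/
lemma IsPoissonPointProcess.lintegral_expNeg_simpleFunc (h : IsPoissonPointProcess P μ X)
    (g : SimpleFunc E ENNReal) (hg : ∀ c ≠ 0, μ (g ⁻¹' {c}) ≠ ⊤) :
    ∫⁻ ω, expNeg (∑' i, g (X i ω)) ∂P = expNeg (∫⁻ x, (1 - expNeg (g x)) ∂μ) := by
  classical
  set S := g.range.filter (· ≠ 0) with hS
  have key (ν : Measure E) (φ : ENNReal → ENNReal) (hφ : φ 0 = 0) :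
      ∫⁻ x, φ (g x) ∂ν = ∑ c ∈ S, φ c * ν (g ⁻¹' {c}) := by
    have h1 : ∫⁻ x, φ (g x) ∂ν = (g.map φ).lintegral ν := by
      rw [← SimpleFunc.lintegral_eq_lintegral]; rfl
    rw [h1, SimpleFunc.map_lintegral, hS, Finset.sum_filter_of_ne]
    rintro c - hc rfl
    exact hc (by simp [hφ])
  have hind : iIndepFun (fun (c : S) ω =>
      Measure.sum (fun i => Measure.dirac (X i ω)) (g ⁻¹' {(c : ENNReal)})) P := by
    -- Independence of counts is given for families indexed by `Fin n`, hence the enumeration of the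
    -- nonzero values.
    have h1 := h.indep (Fintype.card S)
      (fun j => g ⁻¹' {(((Fintype.equivFin S).symm j : S) : ENNReal)})
      (fun j => g.measurableSet_preimage _)
      (fun j k hjk => by
        refine Disjoint.preimage _ (Set.disjoint_singleton.2 fun h => hjk ?_)
        exact (Fintype.equivFin S).symm.injective (Subtype.ext h))
    have h2 := h1.precomp (Fintype.equivFin S).injective
    simpa using h2
  calc ∫⁻ ω, expNeg (∑' i, g (X i ω)) ∂P
      = ∫⁻ ω, ∏ c : S, expNeg (c * Measure.sum (fun i => Measure.dirac (X i ω))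
          (g ⁻¹' {(c : ENNReal)})) ∂P := by
        refine lintegral_congr fun ω => ?_
        have h1 := key (Measure.sum fun i => Measure.dirac (X i ω)) id rfl
        simp only [id] at h1
        rw [tsum_comp_eq_lintegral_counting g.measurable, h1, expNeg_sum,
          Finset.prod_coe_sort S (fun c => expNeg (c * Measure.sum (fun i => Measure.dirac (X i ω))
          (g ⁻¹' {c})))]
    _ = ∏ c : S, ∫⁻ ω, expNeg (c * Measure.sum (fun i => Measure.dirac (X i ω))
          (g ⁻¹' {(c : ENNReal)})) ∂P := by
        refine lintegral_prod_eq_prod_lintegral_of_indepFun _ _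
          (hind.comp (fun c t => expNeg (c * t)) fun c => by fun_prop) fun c => ?_
        have := h.measurable_count (g.measurableSet_preimage {(c : ENNReal)})
        fun_prop
    _ = ∏ c : S, expNeg (μ (g ⁻¹' {(c : ENNReal)}) * (1 - expNeg c)) := by
        refine Finset.prod_congr rfl fun c _ => ?_
        exact h.lintegral_expNeg_count (g.measurableSet_preimage _)
          (hg _ (Finset.mem_filter.1 c.2).2) _
    _ = expNeg (∫⁻ x, (1 - expNeg (g x)) ∂μ) := by
        rw [key μ (fun t => 1 - expNeg t) (by simp [expNeg_zero]), expNeg_sum,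
          Finset.prod_coe_sort S (fun c => expNeg (μ (g ⁻¹' {c}) * (1 - expNeg c)))]
        simp_rw [mul_comm]

/-- The Laplace functional of a Poisson point process. -/
theorem IsPoissonPointProcess.lintegral_expNeg_tsum [IsProbabilityMeasure P] [SigmaFinite μ]
    (h : IsPoissonPointProcess P μ X) {f : E → ENNReal} (hf : Measurable f) :
    ∫⁻ ω, expNeg (∑' i, f (X i ω)) ∂P = expNeg (∫⁻ x, (1 - expNeg (f x)) ∂μ) := by
  have hX := h.measurable
  -- Truncating to the spanning sets gives the nonzero level sets finite measure and keeps the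
  -- approximation monotone.
  set g : ℕ → SimpleFunc E ENNReal := fun n =>
    (SimpleFunc.eapprox f n).restrict (spanningSets μ n) with hg
  have hgx (n : ℕ) (x : E) :
      g n x = (spanningSets μ n).indicator (SimpleFunc.eapprox f n) x := by
    rw [hg, SimpleFunc.restrict_apply _ (measurableSet_spanningSets μ n)]
  have hmono (x : E) : Monotone fun n => g n x := by
    intro m n hmn
    simp only [hgx]
    exact (Set.indicator_le_indicator_of_subset (monotone_spanningSets μ hmn)
      (fun _ => zero_le) x).trans
      (Set.indicator_le_indicator (SimpleFunc.monotone_eapprox f hmn x))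
  have hlim (x : E) : Tendsto (fun n => g n x) atTop (𝓝 (f x)) := by
    have h1 : Tendsto (fun n => SimpleFunc.eapprox f n x) atTop (𝓝 (f x)) := by
      rw [← SimpleFunc.iSup_eapprox_apply hf x]
      exact tendsto_atTop_iSup fun m n hmn => SimpleFunc.monotone_eapprox f hmn x
    refine h1.congr' ?_
    filter_upwards [eventually_ge_atTop (spanningSetsIndex μ x)] with n hn
    rw [hgx, Set.indicator_of_mem (mem_spanningSets_of_index_le μ x hn)]
  have hfin (n : ℕ) (c : ENNReal) (hc : c ≠ 0) : μ (g n ⁻¹' {c}) ≠ ⊤ := by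
    refine ((measure_mono ?_).trans_lt (measure_spanningSets_lt_top μ n)).ne
    intro x hx
    by_contra hxn
    rw [Set.mem_preimage, hgx, Set.indicator_of_notMem hxn] at hx
    exact hc hx.symm
  have hL : Tendsto (fun n => ∫⁻ ω, expNeg (∑' i, g n (X i ω)) ∂P) atTop
      (𝓝 (∫⁻ ω, expNeg (∑' i, f (X i ω)) ∂P)) := by
    refine tendsto_lintegral_of_dominated_convergence (fun _ => 1) (fun n => ?_)
      (fun n => .of_forall fun ω => expNeg_le_one _) (by simp) (.of_forall fun ω => ?_)
    · exact measurable_expNeg.comp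
        (Measurable.tsum fun i => (g n).measurable.comp (hX i))
    · refine (continuous_expNeg.tendsto _).comp ?_
      simp_rw [tsum_comp_eq_lintegral_counting hf,
        tsum_comp_eq_lintegral_counting (g _).measurable]
      exact lintegral_tendsto_of_tendsto_of_monotone (fun n => (g n).measurable.aemeasurable)
        (.of_forall hmono) (.of_forall hlim)
  have hR : Tendsto (fun n => expNeg (∫⁻ x, (1 - expNeg (g n x)) ∂μ)) atTop
      (𝓝 (expNeg (∫⁻ x, (1 - expNeg (f x)) ∂μ))) := by
    refine (continuous_expNeg.tendsto _).comp ?_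
    refine lintegral_tendsto_of_tendsto_of_monotone (fun n => ?_)
      (.of_forall fun x m n hmn => tsub_le_tsub_left (antitone_expNeg (hmono x hmn)) _)
      (.of_forall fun x => ?_)
    · have := (g n).measurable
      fun_prop
    · exact ENNReal.Tendsto.sub tendsto_const_nhds
        ((continuous_expNeg.tendsto _).comp (hlim x)) (Or.inl ENNReal.one_ne_top)
  refine tendsto_nhds_unique hL (hR.congr fun n => ?_)
  exact (h.lintegral_expNeg_simpleFunc (g n) (hfin n)).symm

end FDNetwork

namespace FDNetwork

open Set

/-! ### Gamma, exponential and polar integrals -/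

lemma lintegral_rpow_mul_exp_neg_mul_rpow {p q b : ℝ} (hp : 0 < p) (hq : -1 < q) (hb : 0 < b) :
    ∫⁻ x in Ioi (0 : ℝ), ENNReal.ofReal (x ^ q * Real.exp (-b * x ^ p))
      = ENNReal.ofReal (b ^ (-(q + 1) / p) * (1 / p) * Real.Gamma ((q + 1) / p)) := by
  rw [← integral_rpow_mul_exp_neg_mul_rpow hp hq hb, ofReal_integral_eq_lintegral_ofReal]
  · exact integrableOn_rpow_mul_exp_neg_mul_rpow hq hp hb
  · refine (ae_restrict_iff' measurableSet_Ioi).2 (.of_forall fun x hx => ?_)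
    have : 0 < x := hx
    positivity

lemma lintegral_exp_neg_Ioi (c : ℝ) :
    ∫⁻ x in Ioi c, ENNReal.ofReal (Real.exp (-x)) = ENNReal.ofReal (Real.exp (-c)) := by
  rw [← integral_exp_neg_Ioi, ofReal_integral_eq_lintegral_ofReal]
  · simpa [IntegrableOn] using integrableOn_exp_mul_Ioi (a := -1) (by norm_num) c
  · exact .of_forall fun x => (Real.exp_pos _).le

lemma lintegral_sq_add_sq {G : ℝ → ENNReal} (hG : Measurable G) :
    ∫⁻ p : ℝ × ℝ, G (p.1 ^ 2 + p.2 ^ 2)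
      = ∫⁻ r in Ioi (0 : ℝ), ENNReal.ofReal (2 * Real.pi) * (ENNReal.ofReal r * G (r ^ 2)) := by
  rw [← lintegral_comp_polarCoord_symm (fun p => G (p.1 ^ 2 + p.2 ^ 2)), polarCoord_target,
    Measure.volume_eq_prod, ← Measure.prod_restrict]
  have h1 (p : ℝ × ℝ) : ENNReal.ofReal p.1 • G ((polarCoord.symm p).1 ^ 2
      + (polarCoord.symm p).2 ^ 2) = ENNReal.ofReal p.1 * G (p.1 ^ 2) := by
    rw [polarCoord_symm_apply, smul_eq_mul]
    congr 2
    simp only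
    linear_combination p.1 ^ 2 * Real.sin_sq_add_cos_sq p.2
  simp_rw [h1]
  rw [lintegral_prod _ (by fun_prop)]
  simp only [lintegral_const, Measure.restrict_apply MeasurableSet.univ, univ_inter,
    Real.volume_Ioo]
  refine lintegral_congr fun r => ?_
  rw [mul_comm]
  congr 2
  ring

/-! ### The law of the power of a `CN(0, 1)` variable -/

lemma measurable_complex_mk : Measurable fun p : ℝ × ℝ => (⟨p.1, p.2⟩ : ℂ) :=
  Complex.measurableEquivRealProd.symm.measurable

instance : IsProbabilityMeasure complexNormal :=
  Measure.isProbabilityMeasure_map measurable_complex_mk.aemeasurable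

lemma charFun_complexNormal (t : ℂ) :
    charFun complexNormal t = Complex.exp (-(‖t‖ ^ 2 / 4 : ℝ)) := by
  have h1 (x y : ℝ) : Complex.exp (inner ℝ (⟨x, y⟩ : ℂ) t * Complex.I)
      = Complex.exp (t.re * x * Complex.I) * Complex.exp (t.im * y * Complex.I) := by
    rw [← Complex.exp_add, Complex.inner]
    congr 1
    simp only [Complex.mul_re, Complex.conj_re, Complex.conj_im]
    push_cast
    ring
  rw [charFun_apply, complexNormal, integral_map measurable_complex_mk.aemeasurable
    (by fun_prop)]
  simp_rw [h1]
  rw [integral_prod_mul (μ := gaussianReal 0 (1 / 2)) (ν := gaussianReal 0 (1 / 2))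
    (fun x : ℝ => Complex.exp (t.re * x * Complex.I))
    (fun y : ℝ => Complex.exp (t.im * y * Complex.I)), ← charFun_apply_real, ← charFun_apply_real,
    charFun_gaussianReal, charFun_gaussianReal, ← Complex.exp_add, Complex.sq_norm,
    Complex.normSq_apply]
  congr 1
  push_cast
  ring

/-- The exponential law with mean one on `[0, ∞]`, which is the law of the fading powers. -/
noncomputable def gainLaw : Measure ENNReal :=
  complexNormal.map fun w => ENNReal.ofReal (‖w‖ ^ 2)

instance : IsProbabilityMeasure gainLaw :=
  Measure.isProbabilityMeasure_map (by fun_prop)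

lemma gaussianPDF_half_mul (x y : ℝ) :
    gaussianPDF 0 (1 / 2) x * gaussianPDF 0 (1 / 2) y
      = ENNReal.ofReal (Real.pi⁻¹ * Real.exp (-(x ^ 2 + y ^ 2))) := by
  rw [gaussianPDF, gaussianPDF, ← ENNReal.ofReal_mul (gaussianPDFReal_nonneg _ _ _)]
  congr 1
  have h : (2 : ℝ) * Real.pi * ((1 / 2 : NNReal) : ℝ) = Real.pi := by push_cast; ring
  have h' : (2 : ℝ) * ((1 / 2 : NNReal) : ℝ) = 1 := by push_cast; norm_num
  rw [gaussianPDFReal, gaussianPDFReal, h, h', mul_mul_mul_comm, ← Real.exp_add, ← mul_inv,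
    Real.mul_self_sqrt Real.pi_pos.le]
  congr 2
  ring

lemma lintegral_gainLaw {f : ENNReal → ENNReal} (hf : Measurable f) :
    ∫⁻ e, f e ∂gainLaw
      = ∫⁻ t in Ioi (0 : ℝ), f (ENNReal.ofReal t) * ENNReal.ofReal (Real.exp (-t)) := by
  set G : ℝ → ENNReal := fun t =>
    ENNReal.ofReal (Real.pi⁻¹ * Real.exp (-t)) * f (ENNReal.ofReal t) with hG
  have hGm : Measurable G := by fun_prop
  have h1 : ∫⁻ e, f e ∂gainLaw = ∫⁻ p : ℝ × ℝ, G (p.1 ^ 2 + p.2 ^ 2) := by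
    rw [gainLaw, lintegral_map hf (by fun_prop), complexNormal,
      lintegral_map (by fun_prop) measurable_complex_mk,
      gaussianReal_of_var_ne_zero _ (by norm_num), prod_withDensity (by fun_prop) (by fun_prop),
      lintegral_withDensity_eq_lintegral_mul _ (by fun_prop)
        (by have := measurable_complex_mk; fun_prop)]
    refine lintegral_congr fun p => ?_
    have h : ‖(⟨p.1, p.2⟩ : ℂ)‖ ^ 2 = p.1 ^ 2 + p.2 ^ 2 := by
      rw [Complex.sq_norm, Complex.normSq_mk, sq, sq]
    rw [Pi.mul_apply, gaussianPDF_half_mul, h]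
  have h2 := lintegral_sq_add_sq hGm
  have himg : (fun r : ℝ => r ^ 2) '' Ioi 0 = Ioi 0 := by
    ext x
    constructor
    · rintro ⟨r, hr, rfl⟩
      exact pow_pos (mem_Ioi.1 hr) 2
    · intro hx
      exact ⟨Real.sqrt x, Real.sqrt_pos.2 hx, Real.sq_sqrt (le_of_lt hx)⟩
  -- Substitution t = r² turns the radial integral of the Gaussian density into the exponential
  -- density.
  have h4 := lintegral_image_eq_lintegral_abs_deriv_mul (s := Ioi (0 : ℝ))
    (f := fun r : ℝ => r ^ 2) (f' := fun r => 2 * r) measurableSet_Ioi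
    (fun x _ => by simpa using (hasDerivAt_pow 2 x).hasDerivWithinAt)
    (fun x hx y hy hxy => by
      exact (pow_left_inj₀ (le_of_lt hx) (le_of_lt hy) two_ne_zero).1 hxy)
    (fun t => ENNReal.ofReal Real.pi * G t)
  rw [himg] at h4
  rw [h1, h2]
  calc _ = ∫⁻ t in Ioi (0 : ℝ), ENNReal.ofReal Real.pi * G t := by
        rw [h4]
        refine setLIntegral_congr_fun measurableSet_Ioi fun r hr => ?_
        have hr' : (0 : ℝ) < r := hr
        rw [abs_of_pos (by positivity), ENNReal.ofReal_mul (by norm_num),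
          ENNReal.ofReal_mul (by norm_num)]
        ring
    _ = _ := by
        refine lintegral_congr fun t => ?_
        rw [hG]
        simp only
        rw [← mul_assoc, ← ENNReal.ofReal_mul Real.pi_pos.le, mul_comm, ← mul_assoc,
          mul_inv_cancel₀ Real.pi_ne_zero, one_mul]

lemma gainLaw_Ioi (t : ENNReal) : gainLaw (Ioi t) = expNeg t := by
  rw [← lintegral_indicator_one measurableSet_Ioi,
    lintegral_gainLaw (measurable_one.indicator measurableSet_Ioi)]
  induction t with
  | top => simp [expNeg_top]
  | coe x =>
    have h1 : ∀ t ∈ Ioi (0 : ℝ), (Ioi (x : ENNReal)).indicator 1 (ENNReal.ofReal t)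
        * ENNReal.ofReal (Real.exp (-t))
        = (Ioi (x : ℝ)).indicator (fun t => ENNReal.ofReal (Real.exp (-t))) t := by
      intro t ht
      have : (x : ENNReal) < ENNReal.ofReal t ↔ (x : ℝ) < t := by
        rw [← ENNReal.ofReal_coe_nnreal, ENNReal.ofReal_lt_ofReal_iff ht]
      by_cases h : (x : ℝ) < t
      · simp [indicator, this, h]
      · simp [indicator, this, h]
    rw [setLIntegral_congr_fun measurableSet_Ioi h1, setLIntegral_indicator measurableSet_Ioi,
      inter_eq_self_of_subset_left (Ioi_subset_Ioi x.coe_nonneg), lintegral_exp_neg_Ioi,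
      ← expNeg_ofReal x.coe_nonneg, ENNReal.ofReal_coe_nnreal]

lemma gainLaw_singleton_zero : gainLaw {0} = 0 := by
  have h : ({0} : Set ENNReal) = (Ioi 0)ᶜ := by ext; simp
  rw [h, prob_compl_eq_one_sub measurableSet_Ioi, gainLaw_Ioi, expNeg_zero, tsub_self]

/-- Laplace transform of the exponential law. At u = ∞ it vanishes because the gain is almost surely
nonzero. -/
lemma lintegral_expNeg_mul_gainLaw (u : ENNReal) :
    ∫⁻ e, expNeg (u * e) ∂gainLaw = (1 + u)⁻¹ := by
  induction u with
  | top =>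
    rw [add_top, ENNReal.inv_top]
    refine lintegral_eq_zero_of_ae_eq_zero ?_
    have h : ∀ᵐ e ∂gainLaw, e ≠ 0 := by
      rw [ae_iff]; simpa using gainLaw_singleton_zero
    filter_upwards [h] with e he
    simp [ENNReal.top_mul he, expNeg_top]
  | coe x =>
    rw [lintegral_gainLaw (by fun_prop)]
    have h1 : ∀ t ∈ Ioi (0 : ℝ), expNeg (x * ENNReal.ofReal t) * ENNReal.ofReal (Real.exp (-t))
        = ENNReal.ofReal (t ^ (0 : ℝ) * Real.exp (-(1 + x : ℝ) * t ^ (1 : ℝ))) := by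
      intro t ht
      have ht' : (0 : ℝ) < t := ht
      rw [← ENNReal.ofReal_coe_nnreal, ← ENNReal.ofReal_mul x.coe_nonneg,
        expNeg_ofReal (by positivity), ← ENNReal.ofReal_mul (Real.exp_pos _).le, ← Real.exp_add,
        Real.rpow_zero, Real.rpow_one]
      ring_nf
    have hx : (0 : ℝ) < 1 + x := by positivity
    rw [setLIntegral_congr_fun measurableSet_Ioi h1,
      lintegral_rpow_mul_exp_neg_mul_rpow one_pos (by norm_num) hx]
    norm_num
    rw [Real.rpow_neg_one, ENNReal.ofReal_inv_of_pos hx, ENNReal.ofReal_add zero_le_one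
      x.coe_nonneg, ENNReal.ofReal_one, ENNReal.ofReal_coe_nnreal]

lemma lintegral_mul_expNeg_mul_gainLaw {u : ℝ} (hu : 0 ≤ u) :
    ∫⁻ e, ENNReal.ofReal u * e * expNeg (ENNReal.ofReal u * e) ∂gainLaw
      = ENNReal.ofReal (u / (1 + u) ^ 2) := by
  rw [lintegral_gainLaw (by fun_prop)]
  have h1 : ∀ t ∈ Ioi (0 : ℝ), ENNReal.ofReal u * ENNReal.ofReal t *
      expNeg (ENNReal.ofReal u * ENNReal.ofReal t) * ENNReal.ofReal (Real.exp (-t))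
      = ENNReal.ofReal u *
        ENNReal.ofReal (t ^ (1 : ℝ) * Real.exp (-(1 + u : ℝ) * t ^ (1 : ℝ))) := by
    intro t ht
    have ht' : (0 : ℝ) < t := ht
    rw [← ENNReal.ofReal_mul hu, expNeg_ofReal (by positivity),
      ← ENNReal.ofReal_mul (by positivity), ← ENNReal.ofReal_mul (by positivity),
      ← ENNReal.ofReal_mul hu, mul_assoc, ← Real.exp_add, Real.rpow_one, mul_assoc]
    ring_nf
  have hx : (0 : ℝ) < 1 + u := by positivity
  rw [setLIntegral_congr_fun measurableSet_Ioi h1, lintegral_const_mul _ (by fun_prop),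
    lintegral_rpow_mul_exp_neg_mul_rpow one_pos (by norm_num) hx, ← ENNReal.ofReal_mul hu]
  norm_num [div_eq_mul_inv]

/-- Tail of the Gamma(2) law, that is, of the MRC gain ‖h‖². Given one summand e, the other must
exceed the truncated difference t - e. -/
lemma gainLaw_prod_add_gt (t : ENNReal) :
    (gainLaw.prod gainLaw) {p | t < p.1 + p.2} = (1 + t) * expNeg t := by
  rw [Measure.prod_apply (measurableSet_lt (by fun_prop) (by fun_prop))]
  induction t with
  | top => simp [expNeg_top]
  | coe x =>
    have h1 (e : ENNReal) : gainLaw (Prod.mk e ⁻¹' {p : ENNReal × ENNReal | (x : ENNReal)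
        < p.1 + p.2}) = expNeg (x - e) := by
      rcases le_or_gt e x with h | h
      · rw [← gainLaw_Ioi]
        congr 1
        ext f
        simp only [mem_preimage, mem_ofPred_eq, mem_Ioi]
        exact (ENNReal.sub_lt_iff_lt_left (h.trans_lt ENNReal.coe_lt_top).ne h).symm
      · rw [tsub_eq_zero_of_le h.le, expNeg_zero, ← measure_univ (μ := gainLaw)]
        congr 1
        ext f
        simpa using h.trans_le le_self_add
    simp_rw [h1]
    rw [lintegral_gainLaw (by fun_prop),
      ← lintegral_inter_add_sdiff _ _ (measurableSet_Ioi (a := (x : ℝ))),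
      inter_eq_self_of_subset_right (Ioi_subset_Ioi x.coe_nonneg)]
    have h2 : ∀ t ∈ Ioi (x : ℝ), expNeg (x - ENNReal.ofReal t) * ENNReal.ofReal (Real.exp (-t))
        = ENNReal.ofReal (Real.exp (-t)) := by
      intro t ht
      rw [← ENNReal.ofReal_coe_nnreal, tsub_eq_zero_of_le (ENNReal.ofReal_le_ofReal (le_of_lt ht)),
        expNeg_zero, one_mul]
    -- Below x the integrand is constant, and the length x of this range produces the term x
    -- exp(-x).
    have h3 : ∀ t ∈ Ioi (0 : ℝ) \ Ioi (x : ℝ), expNeg (x - ENNReal.ofReal t)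
        * ENNReal.ofReal (Real.exp (-t)) = ENNReal.ofReal (Real.exp (-x)) := by
      intro t ht
      have h0 : (0 : ℝ) < t := ht.1
      have h0' : t ≤ x := not_lt.1 ht.2
      rw [← ENNReal.ofReal_coe_nnreal, ← ENNReal.ofReal_sub _ h0.le,
        expNeg_ofReal (by linarith), ← ENNReal.ofReal_mul (Real.exp_pos _).le, ← Real.exp_add]
      congr 2
      ring
    rw [setLIntegral_congr_fun measurableSet_Ioi h2, lintegral_exp_neg_Ioi,
      setLIntegral_congr_fun (measurableSet_Ioi.diff measurableSet_Ioi) h3, setLIntegral_const,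
      Ioi_sdiff_Ioi, Real.volume_Ioc, ← expNeg_ofReal x.coe_nonneg, ENNReal.ofReal_coe_nnreal,
      sub_zero, ENNReal.ofReal_coe_nnreal]
    ring

/-! ### Rayleigh fading -/

instance : IsProbabilityMeasure rayleigh :=
  Measure.isProbabilityMeasure_map (by fun_prop)

/-- The law of `v^H h` for a unit vector `v`. -/
lemma rayleigh_map_inner {v : Channel} (hv : ‖v‖ = 1) :
    rayleigh.map (fun h => inner ℂ v h) = complexNormal := by
  have : IsProbabilityMeasure (rayleigh.map (fun h => inner ℂ v h)) :=
    Measure.isProbabilityMeasure_map (by fun_prop)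
  refine Measure.ext_of_charFun (funext fun t => ?_)
  rw [charFun_complexNormal, charFun_apply, rayleigh, integral_map (by fun_prop) (by fun_prop),
    integral_map (by fun_prop) (by fun_prop)]
  -- The characteristic function splits over the two independent coordinates. Its exponents
  -- recombine because ‖v‖ = 1.
  have h1 (h : Fin 2 → ℂ) :
      Complex.exp (inner ℝ (inner ℂ v (WithLp.toLp 2 h)) t * Complex.I)
        = ∏ j, Complex.exp (inner ℝ (h j) (v j * t) * Complex.I) := by
    rw [← Complex.exp_sum, ← Finset.sum_mul]
    congr 2
    simp only [PiLp.inner_apply, Fin.sum_univ_two, Complex.inner, RCLike.inner_apply,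
      Complex.mul_re, Complex.mul_im, Complex.add_re, Complex.add_im, Complex.conj_re,
      Complex.conj_im, map_add, map_mul]
    push_cast
    ring
  simp_rw [h1]
  rw [integral_fintype_prod_eq_prod (μ := fun _ : Fin 2 => complexNormal)
    (fun j x => Complex.exp (inner ℝ x (v j * t) * Complex.I))]
  simp_rw [← charFun_apply, charFun_complexNormal, ← Complex.exp_sum]
  congr 1
  have h2 : ‖v 0‖ ^ 2 + ‖v 1‖ ^ 2 = 1 := by
    have := EuclideanSpace.norm_sq_eq v
    rw [hv, Fin.sum_univ_two] at this
    linarith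
  rw [Fin.sum_univ_two, ← neg_add, ← Complex.ofReal_add]
  congr 2
  rw [norm_mul, norm_mul]
  linear_combination (‖t‖ ^ 2 / 4) * h2

@[fun_prop]
lemma measurable_gain {α : Type*} [MeasurableSpace α] {v h : α → Channel} (hv : Measurable v)
    (hh : Measurable h) : Measurable fun a => gain (v a) (h a) := by
  unfold gain
  fun_prop

lemma rayleigh_map_gain {v : Channel} (hv : ‖v‖ = 1) : rayleigh.map (gain v) = gainLaw := by
  rw [gainLaw, ← rayleigh_map_inner hv, Measure.map_map (by fun_prop) (by fun_prop)]
  rfl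

lemma rayleigh_map_norm_sq (t : ENNReal) :
    rayleigh {h | t < ENNReal.ofReal (‖h‖ ^ 2)} = (1 + t) * expNeg t := by
  have hm : Measurable fun w : ℂ => ENNReal.ofReal (‖w‖ ^ 2) := by fun_prop
  rw [← gainLaw_prod_add_gt, gainLaw, Measure.map_prod_map _ _ hm hm,
    Measure.map_apply (hm.prodMap hm) (measurableSet_lt (by fun_prop) (by fun_prop)),
    ← (measurePreserving_finTwoArrow complexNormal).map_eq,
    Measure.map_apply (MeasurableEquiv.measurable _)
      ((hm.prodMap hm) (measurableSet_lt (by fun_prop) (by fun_prop))),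
    rayleigh, Measure.map_apply (by fun_prop) (measurableSet_lt (by fun_prop) (by fun_prop))]
  congr 1
  ext h
  simp [EuclideanSpace.norm_sq_eq, ENNReal.ofReal_add, MeasurableEquiv.finTwoArrow]

lemma rayleigh_singleton_zero : rayleigh {0} = 0 := by
  have h : ({0} : Set Channel) = {h | 0 < ENNReal.ofReal (‖h‖ ^ 2)}ᶜ := by
    ext; simp
  rw [h, prob_compl_eq_one_sub (measurableSet_lt (by fun_prop) (by fun_prop)),
    rayleigh_map_norm_sq, expNeg_zero]
  simp

end FDNetwork

namespace FDNetwork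

open Set

/-! ### Path-loss integrals over the plane -/

lemma lintegral_plane_norm {H : ℝ → ENNReal} (hH : Measurable H) :
    ∫⁻ x : Plane, H ‖x‖
      = ENNReal.ofReal (2 * Real.pi) * ∫⁻ r in Ioi (0 : ℝ), ENNReal.ofReal r * H r := by
  have hm : Measurable fun t : ℝ => H (Real.sqrt t) := by fun_prop
  have h1 : ∫⁻ x : Plane, H ‖x‖ = ∫⁻ p : ℝ × ℝ, H (Real.sqrt (p.1 ^ 2 + p.2 ^ 2)) := by
    rw [← (volume_preserving_finTwoArrow ℝ).lintegral_comp (by fun_prop),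
      ← (EuclideanSpace.volume_preserving_symm_measurableEquiv_toLp (Fin 2)).lintegral_comp
        (f := fun x : Fin 2 → ℝ => H (Real.sqrt ((MeasurableEquiv.finTwoArrow x).1 ^ 2
          + (MeasurableEquiv.finTwoArrow x).2 ^ 2))) (by fun_prop)]
    refine lintegral_congr fun x => ?_
    rw [EuclideanSpace.norm_eq, Fin.sum_univ_two, Real.norm_eq_abs, Real.norm_eq_abs, sq_abs,
      sq_abs]
    rfl
  rw [h1, lintegral_sq_add_sq hm, lintegral_const_mul _ (by fun_prop)]
  congr 1
  refine setLIntegral_congr_fun measurableSet_Ioi fun r hr => ?_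
  rw [Real.sqrt_sq (le_of_lt hr)]

/-- Writing (1 + r^α / c)^(-2) as a Gamma integral in g and exchanging the integrals leaves a Gamma
integral in r, then one in g. The latter converges because 2/α < 1. -/
lemma lintegral_mul_div_one_add_sq {α c : ℝ} (hα : 2 < α) (hc : 0 < c) :
    ∫⁻ r in Ioi (0 : ℝ), ENNReal.ofReal (r * (c * r ^ (-α) / (1 + c * r ^ (-α)) ^ 2))
      = ENNReal.ofReal (c ^ (2 / α) / α * (Real.Gamma (1 + 2 / α) * Real.Gamma (1 - 2 / α))) := by
  have hα0 : 0 < α := by linarith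
  have hδ : 2 / α < 1 := by rw [div_lt_one hα0]; exact hα
  have hδ0 : 0 < 2 / α := by positivity
  set F : ℝ → ℝ → ENNReal := fun r g =>
    ENNReal.ofReal (g / c * Real.exp (-g) * (r ^ (1 + α) * Real.exp (-(g / c) * r ^ α))) with hF
  have h1 : ∀ r ∈ Ioi (0 : ℝ), ENNReal.ofReal (r * (c * r ^ (-α) / (1 + c * r ^ (-α)) ^ 2))
      = ∫⁻ g in Ioi (0 : ℝ), F r g := by
    intro r hr
    have hr0 : (0 : ℝ) < r := hr
    have hra : 0 < r ^ α := Real.rpow_pos_of_pos hr0 α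
    have h2 : ∀ g ∈ Ioi (0 : ℝ), F r g = ENNReal.ofReal (r ^ (1 + α) / c) *
        ENNReal.ofReal (g ^ (1 : ℝ) * Real.exp (-(1 + r ^ α / c) * g ^ (1 : ℝ))) := by
      intro g hg
      rw [← ENNReal.ofReal_mul (by positivity)]
      refine congrArg ENNReal.ofReal ?_
      have h3 : -(1 + r ^ α / c) * g ^ (1 : ℝ) = -g + -(g / c) * r ^ α := by
        rw [Real.rpow_one]; ring
      rw [h3, Real.exp_add, Real.rpow_one]
      ring
    rw [setLIntegral_congr_fun measurableSet_Ioi h2, lintegral_const_mul _ (by fun_prop),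
      lintegral_rpow_mul_exp_neg_mul_rpow one_pos (by norm_num) (by positivity),
      ← ENNReal.ofReal_mul (by positivity)]
    congr 1
    norm_num
    rw [Real.rpow_neg hr0.le, Real.rpow_add hr0, Real.rpow_one]
    field_simp
    rw [add_comm]
  rw [setLIntegral_congr_fun measurableSet_Ioi h1, lintegral_lintegral_swap (by
    refine Measurable.aemeasurable ?_
    simp only [hF]
    fun_prop)]
  have h4 : ∀ g ∈ Ioi (0 : ℝ), ∫⁻ r in Ioi (0 : ℝ), F r g
      = ENNReal.ofReal (c ^ (2 / α) / α * Real.Gamma (1 + 2 / α)) *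
        ENNReal.ofReal (g ^ (-(2 / α)) * Real.exp (-1 * g ^ (1 : ℝ))) := by
    intro g hg
    have hg0 : (0 : ℝ) < g := hg
    have h5 (r : ℝ) : F r g = ENNReal.ofReal (g / c * Real.exp (-g)) *
        ENNReal.ofReal (r ^ (1 + α) * Real.exp (-(g / c) * r ^ α)) := by
      rw [← ENNReal.ofReal_mul (by positivity)]
    simp_rw [h5]
    rw [lintegral_const_mul _ (by fun_prop),
      lintegral_rpow_mul_exp_neg_mul_rpow hα0 (by linarith) (by positivity),
      ← ENNReal.ofReal_mul (by positivity), ← ENNReal.ofReal_mul (by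
        have := Real.Gamma_pos_of_pos (show 0 < 1 + 2 / α by positivity)
        positivity)]
    congr 1
    have h6 : -(1 + α + 1) / α = -(2 / α) - 1 := by field_simp; ring
    have h7 : (1 + α + 1) / α = 1 + 2 / α := by field_simp; ring
    rw [h6, h7, Real.rpow_sub (by positivity), Real.rpow_one, Real.div_rpow hg0.le hc.le,
      Real.rpow_neg hc.le, Real.rpow_one]
    have := Real.rpow_pos_of_pos hc (2 / α)
    have := Real.rpow_pos_of_pos hg0 (-(2 / α))
    field_simp
  rw [setLIntegral_congr_fun measurableSet_Ioi h4, lintegral_const_mul _ (by fun_prop),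
    lintegral_rpow_mul_exp_neg_mul_rpow one_pos (by linarith) one_pos, ← ENNReal.ofReal_mul (by
        have := Real.Gamma_pos_of_pos (show 0 < 1 + 2 / α by positivity)
        positivity)]
  congr 1
  rw [Real.one_rpow, div_one, div_one, one_mul, one_mul, show -(2 / α) + 1 = 1 - 2 / α by ring]
  ring

lemma pathLoss_eq_enorm (α : ℝ) (x z : Plane) : pathLoss α x z = ‖x - z‖ₑ ^ (-α) := by
  rw [pathLoss, edist_eq_enorm_sub]

/-- By translation invariance neither the receiver's position nor the displacement w of a UL node
from its BS affects spatial averages. -/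
lemma lintegral_pathLoss_comp (α : ℝ) (z w : Plane) (F : ENNReal → ENNReal) :
    ∫⁻ x : Plane, F (pathLoss α (x + w) z) = ∫⁻ x : Plane, F (‖x‖ₑ ^ (-α)) := by
  simp_rw [pathLoss_eq_enorm]
  rw [← lintegral_add_right_eq_self (fun x : Plane => F (‖x‖ₑ ^ (-α))) (w - z)]
  refine lintegral_congr fun x => ?_
  rw [add_sub_assoc]

/-- `∫ A / (1 + A)² dx` over the plane for `A = c ‖x‖ ^ (-α)`. -/
noncomputable def spatialConst (α c : ℝ) : ℝ :=
  c ^ (2 / α) * (4 * Real.pi ^ 2 / α ^ 2) / Real.sin (2 * Real.pi / α)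

lemma sin_two_pi_div_pos {α : ℝ} (hα : 2 < α) : 0 < Real.sin (2 * Real.pi / α) := by
  have hα0 : 0 < α := by linarith
  refine Real.sin_pos_of_pos_of_lt_pi (by positivity) ?_
  rw [div_lt_iff₀ hα0]
  nlinarith [Real.pi_pos]

lemma spatialConst_nonneg {α c : ℝ} (hα : 2 < α) (hc : 0 < c) : 0 ≤ spatialConst α c := by
  have := sin_two_pi_div_pos hα
  unfold spatialConst
  positivity

lemma lintegral_pathLoss_ratio {α c : ℝ} (hα : 2 < α) (hc : 0 < c) (z w : Plane) :
    ∫⁻ x : Plane, ENNReal.ofReal c * pathLoss α (x + w) z *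
        ((1 + ENNReal.ofReal c * pathLoss α (x + w) z)⁻¹) ^ 2
      = ENNReal.ofReal (spatialConst α c) := by
  have hα0 : 0 < α := by linarith
  have hδ : 2 / α < 1 := by rw [div_lt_one hα0]; exact hα
  have hδ0 : 0 < 2 / α := by positivity
  rw [lintegral_pathLoss_comp α z w (fun p => ENNReal.ofReal c * p *
        ((1 + ENNReal.ofReal c * p)⁻¹) ^ 2)]
  have h1 := lintegral_plane_norm (H := fun r : ℝ => ENNReal.ofReal c * ENNReal.ofReal r ^ (-α) *
    ((1 + ENNReal.ofReal c * ENNReal.ofReal r ^ (-α))⁻¹) ^ 2) (by fun_prop)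
  simp only [ofReal_norm] at h1
  rw [h1]
  have h2 : ∀ r ∈ Ioi (0 : ℝ), ENNReal.ofReal r * (ENNReal.ofReal c * ENNReal.ofReal r ^ (-α) *
        ((1 + ENNReal.ofReal c * ENNReal.ofReal r ^ (-α))⁻¹) ^ 2)
        = ENNReal.ofReal (r * (c * r ^ (-α) / (1 + c * r ^ (-α)) ^ 2)) := by
    intro r hr
    have hr0 : (0 : ℝ) < r := hr
    have hra : 0 < r ^ (-α) := Real.rpow_pos_of_pos hr0 _
    rw [ENNReal.ofReal_rpow_of_pos hr0, ← ENNReal.ofReal_mul hc.le, ← ENNReal.ofReal_one,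
      ← ENNReal.ofReal_add zero_le_one (by positivity), ← ENNReal.ofReal_inv_of_pos (by positivity),
      ← ENNReal.ofReal_pow (by positivity), ← ENNReal.ofReal_mul (by positivity),
      ← ENNReal.ofReal_mul hr0.le]
    rw [inv_pow, div_eq_mul_inv]
  rw [setLIntegral_congr_fun measurableSet_Ioi h2, lintegral_mul_div_one_add_sq hα hc,
    ← ENNReal.ofReal_mul (by positivity)]
  congr 1
  -- Euler's reflection formula is the source of the sine.
  have h3 := Real.Gamma_mul_Gamma_one_sub (2 / α)
  rw [add_comm 1 (2 / α), Real.Gamma_add_one hδ0.ne', mul_assoc (2 / α), h3, spatialConst]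
  rw [show Real.pi * (2 / α) = 2 * Real.pi / α by ring]
  have := (sin_two_pi_div_pos hα).ne'
  field_simp
  ring

lemma one_sub_inv_one_add_le (A : ENNReal) (hA : A ≤ 1) :
    1 - (1 + A)⁻¹ ≤ 2 * (A * ((1 + A)⁻¹) ^ 2) := by
  lift A to NNReal using (hA.trans_lt ENNReal.one_lt_top).ne
  have hA' : (A : ℝ) ≤ 1 := by exact_mod_cast hA
  have h1 : ((1 : ENNReal) + A)⁻¹ = ((1 + A)⁻¹ : NNReal) := by
    rw [ENNReal.coe_inv (by positivity)]; simp
  rw [h1]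
  norm_cast
  rw [← NNReal.coe_le_coe, NNReal.coe_sub (by
    rw [← NNReal.coe_le_coe]; push_cast; exact inv_le_one_of_one_le₀ (by linarith [A.coe_nonneg]))]
  push_cast
  have h2 : (0 : ℝ) < 1 + A := by positivity
  have h3 : 1 - (1 + (A : ℝ))⁻¹ = A * (1 + A) * ((1 + (A : ℝ))⁻¹) ^ 2 := by field_simp; ring
  rw [h3]
  have h4 : (0 : ℝ) ≤ ((1 + (A : ℝ))⁻¹) ^ 2 := by positivity
  nlinarith [mul_nonneg A.coe_nonneg h4]

/-- Near the receiver the integrand is at most 1. Far away, where A ≤ 1, it is at most twice A / (1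
+ A)², whose integral is already known. -/
lemma lintegral_one_sub_inv_pathLoss_ne_top {α c : ℝ} (hα : 2 < α) (hc : 0 < c) (z w : Plane) :
    ∫⁻ x : Plane, (1 - (1 + ENNReal.ofReal c * pathLoss α (x + w) z)⁻¹) ≠ ⊤ := by
  have hα0 : 0 < α := by linarith
  have hK := lintegral_pathLoss_ratio hα hc 0 0
  simp_rw [pathLoss_eq_enorm, add_zero, sub_zero] at hK
  rw [lintegral_pathLoss_comp α z w (fun p => 1 - (1 + ENNReal.ofReal c * p)⁻¹)]
  -- This radius is where c ‖x‖^(-α) equals 1.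
  set B : Set Plane := Metric.closedBall 0 (c ^ (1 / α)) with hB
  have hle (x : Plane) : 1 - (1 + ENNReal.ofReal c * ‖x‖ₑ ^ (-α))⁻¹ ≤ B.indicator 1 x +
      2 * (ENNReal.ofReal c * ‖x‖ₑ ^ (-α) * ((1 + ENNReal.ofReal c * ‖x‖ₑ ^ (-α))⁻¹) ^ 2) := by
    by_cases hx : x ∈ B
    · rw [indicator_of_mem hx, Pi.one_apply]
      exact tsub_le_self.trans le_self_add
    · rw [indicator_of_notMem hx, zero_add]
      refine one_sub_inv_one_add_le _ ?_
      have hx' : c ^ (1 / α) < ‖x‖ := by simpa [hB] using hx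
      have hx0 : 0 < ‖x‖ := lt_of_le_of_lt (by positivity) hx'
      rw [← ofReal_norm, ENNReal.ofReal_rpow_of_pos hx0, ← ENNReal.ofReal_mul hc.le,
        ENNReal.ofReal_le_one, Real.rpow_neg hx0.le, ← div_eq_mul_inv,
        div_le_one (by positivity)]
      have := Real.rpow_le_rpow (by positivity) hx'.le hα0.le
      rwa [← Real.rpow_mul hc.le, one_div_mul_cancel hα0.ne', Real.rpow_one] at this
  refine ((lintegral_mono hle).trans_lt ?_).ne
  rw [lintegral_add_left (measurable_one.indicator Metric.isClosed_closedBall.measurableSet),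
    lintegral_indicator_one Metric.isClosed_closedBall.measurableSet,
    lintegral_const_mul _ (by fun_prop), hK]
  exact ENNReal.add_lt_top.2 ⟨measure_closedBall_lt_top,
    ENNReal.mul_lt_top ENNReal.ofNat_lt_top ENNReal.ofReal_lt_top⟩

end FDNetwork

namespace FDNetwork

open Set Filter Topology

/-! ### Product measures -/

lemma prod_infinitePi_map_elim {β : Type*} [MeasurableSpace β] (μ : Measure β)
    [IsProbabilityMeasure μ] :
    (μ.prod (Measure.infinitePi fun _ : ℕ => μ)).map
        (fun p (c : Option ℕ) => c.elim p.1 p.2) = Measure.infinitePi fun _ : Option ℕ => μ := by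
  classical
  have hm : Measurable fun (p : β × (ℕ → β)) (c : Option ℕ) => c.elim p.1 p.2 := by
    refine measurable_pi_lambda _ fun c => ?_
    cases c <;> simp only [Option.elim_none, Option.elim_some] <;> fun_prop
  refine Measure.eq_infinitePi _ fun s t ht => ?_
  rw [Measure.map_apply hm (MeasurableSet.pi s.countable_toSet fun i _ => ht i)]
  have hpre : (fun (p : β × (ℕ → β)) (c : Option ℕ) => c.elim p.1 p.2) ⁻¹' ((s : Set _).pi t)
      = (if none ∈ s then t none else univ) ×ˢ
        ((Finset.eraseNone s : Set ℕ).pi fun i => t (some i)) := by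
    ext p
    simp only [mem_preimage, Set.mem_pi, mem_prod, Finset.mem_coe, Finset.mem_eraseNone]
    constructor
    · intro h
      refine ⟨?_, fun i hi => h (some i) hi⟩
      split_ifs with hn
      · exact h none hn
      · trivial
    · rintro ⟨h0, h1⟩ (_ | i) hi
      · simpa [hi] using h0
      · exact h1 i hi
  rw [hpre, Measure.prod_prod, Measure.infinitePi_pi _ fun i _ => ht (some i)]
  split_ifs with hn
  · conv_rhs => rw [← Finset.insert_eq_of_mem hn, ← Finset.insertNone_eraseNone,
      Finset.prod_insertNone]
  · conv_rhs => rw [← Finset.erase_eq_of_notMem hn, ← Finset.map_some_eraseNone,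
      Finset.prod_map]
    simp

lemma lintegral_prod_reorder {A B C D : Type*} [MeasurableSpace A] [MeasurableSpace B]
    [MeasurableSpace C] [MeasurableSpace D] (ξ : Measure A) (β : Measure B) (γ : Measure C)
    (ρ : Measure D) [SFinite ξ] [SFinite β] [SFinite γ] [SFinite ρ]
    {f : A → B → C → D → ENNReal}
    (hf : Measurable fun p : A × B × C × D => f p.1 p.2.1 p.2.2.1 p.2.2.2) :
    ∫⁻ x, ∫⁻ m, ∫⁻ k, f x m.1 m.2 k ∂ρ ∂(β.prod γ) ∂ξ
      = ∫⁻ b, ∫⁻ x, ∫⁻ k, ∫⁻ c, f x b c k ∂γ ∂ρ ∂ξ ∂β := by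
  have h1 (x : A) : ∫⁻ m, ∫⁻ k, f x m.1 m.2 k ∂ρ ∂(β.prod γ)
      = ∫⁻ b, ∫⁻ k, ∫⁻ c, f x b c k ∂γ ∂ρ ∂β := by
    rw [lintegral_prod]
    · refine lintegral_congr fun b => ?_
      rw [lintegral_lintegral_swap]
      exact (hf.comp (by fun_prop : Measurable fun p : C × D => (x, b, p.1, p.2))).aemeasurable
    · refine Measurable.aemeasurable (Measurable.lintegral_prod_right ?_)
      exact hf.comp (by fun_prop : Measurable fun p : (B × C) × D => (x, p.1.1, p.1.2, p.2))
  simp_rw [h1]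
  rw [lintegral_lintegral_swap]
  refine Measurable.aemeasurable ?_
  refine Measurable.lintegral_prod_right (f := fun (y : A × B) (k : D) => ∫⁻ c, f y.1 y.2 c k ∂γ) ?_
  refine Measurable.lintegral_prod_right
    (f := fun (y : (A × B) × D) (c : C) => f y.1.1 y.1.2 c y.2) ?_
  exact hf.comp (by fun_prop :
    Measurable fun p : ((A × B) × D) × C => (p.1.1.1, p.1.1.2, p.2, p.1.2))

/-- Finite products factor by independence, and dominated convergence passes to the infinite one.
Writing the result through `negLog` makes it the exponential of a sum, the shape required by the
Laplace functional. -/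
lemma lintegral_infinitePi_expNeg_tsum {β : Type*} [MeasurableSpace β] (ν : Measure β)
    [IsProbabilityMeasure ν] {h : ℕ → β → ENNReal} (hh : ∀ i, Measurable (h i)) :
    ∫⁻ k, expNeg (∑' i, h i (k i)) ∂(Measure.infinitePi fun _ : ℕ => ν)
      = expNeg (∑' i, negLog (∫⁻ y, expNeg (h i y) ∂ν)) := by
  have hle (i : ℕ) : ∫⁻ y, expNeg (h i y) ∂ν ≤ 1 := by
    simpa using lintegral_mono (μ := ν) fun y => expNeg_le_one (h i y)
  have hL : Tendsto (fun n => ∫⁻ k, ∏ i ∈ Finset.range n, expNeg (h i (k i))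
      ∂(Measure.infinitePi fun _ : ℕ => ν)) atTop
      (𝓝 (∫⁻ k, expNeg (∑' i, h i (k i)) ∂(Measure.infinitePi fun _ : ℕ => ν))) := by
    refine tendsto_lintegral_of_dominated_convergence (fun _ => 1) (fun n => by fun_prop)
      (fun n => .of_forall fun k => ?_) (by simp) (.of_forall fun k => tendsto_prod_expNeg _)
    exact Finset.prod_le_one' fun i _ => expNeg_le_one _
  refine tendsto_nhds_unique hL ((tendsto_prod_expNeg _).congr fun n => ?_)
  have hind := iIndepFun_infinitePi (P := fun _ : ℕ => ν)
    (X := fun i y => expNeg (h i y)) (fun i => by fun_prop)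
  rw [lintegral_prod_eq_prod_lintegral_of_indepFun _ _ hind (fun i => by fun_prop)]
  refine Finset.prod_congr rfl fun i _ => ?_
  rw [expNeg_negLog (hle i)]
  have := (measurePreserving_eval_infinitePi (fun _ : ℕ => ν) i).lintegral_comp
    (f := fun y => expNeg (h i y)) (by fun_prop)
  exact this.symm

/-! ### Interference from the other cells -/

instance : IsProbabilityMeasure uniformAngle := by
  refine cond_isProbabilityMeasure_of_finite ?_ ?_ <;> rw [Real.volume_Icc]
  · simp [Real.pi_pos]
  · exact ENNReal.ofReal_ne_top

instance : IsProbabilityMeasure cellLaw := by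
  unfold cellLaw; infer_instance

/-- The UL direction of a cell, and the fading powers seen through a combining vector from its
BS and from its UL node. -/
abbrev CellGain : Type := ℝ × (ENNReal × ENNReal)

/-- The law of `cellGain v` for a unit vector `v`. -/
noncomputable def cellGainLaw : Measure CellGain := uniformAngle.prod (gainLaw.prod gainLaw)

instance : IsProbabilityMeasure cellGainLaw := by
  unfold cellGainLaw; infer_instance

/-- The part of a mark which is relevant when the combining vector is `v`. -/
noncomputable def cellGain (v : Channel) (m : CellMark) : CellGain :=
  (m.ulAngle, gain v m.bsChannel, gain v m.ulChannel)

@[fun_prop]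
lemma measurable_cellGain {β : Type*} [MeasurableSpace β] {v : β → Channel} {m : β → CellMark}
    (hv : Measurable v) (hm : Measurable m) : Measurable fun b => cellGain (v b) (m b) := by
  unfold cellGain CellMark.ulAngle CellMark.bsChannel CellMark.ulChannel
  fun_prop

lemma cellLaw_map_cellGain {v : Channel} (hv : ‖v‖ = 1) :
    cellLaw.map (cellGain v) = cellGainLaw := by
  have hg : Measurable (gain v) := by fun_prop
  rw [cellGainLaw, ← rayleigh_map_gain hv, Measure.map_prod_map _ _ hg hg]
  have h1 : uniformAngle = (uniformAngle.prod uniformAngle).map Prod.fst := by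
    rw [Measure.map_fst_prod]; simp
  conv_rhs => rw [h1, Measure.map_prod_map _ _ measurable_fst (hg.prodMap hg)]
  rfl

@[fun_prop]
lemma measurable_pointAt {β : Type*} [MeasurableSpace β] {x : β → Plane} {φ : β → ℝ} {r : ℝ}
    (hx : Measurable x) (hφ : Measurable φ) : Measurable fun b => pointAt (x b) r (φ b) := by
  unfold pointAt
  have : Measurable fun b => !₂[Real.cos (φ b), Real.sin (φ b)] := by
    refine (WithLp.measurable_toLp 2 _).comp (measurable_pi_lambda _ fun i => ?_)
    fin_cases i <;> simp <;> fun_prop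
  fun_prop

@[fun_prop]
lemma measurable_pathLoss {β : Type*} [MeasurableSpace β] {x z : β → Plane} {α : ℝ}
    (hx : Measurable x) (hz : Measurable z) : Measurable fun b => pathLoss α (x b) (z b) := by
  unfold pathLoss
  fun_prop

/-- Interference at `z` from the cell of the BS at `x`. -/
noncomputable def interTerm (α rhoU rhoB R : ℝ) (z x : Plane) (k : CellGain) : ENNReal :=
  ENNReal.ofReal rhoB * pathLoss α x z * k.2.1
    + ENNReal.ofReal rhoU * pathLoss α (pointAt x R k.1) z * k.2.2

/-- Inter-cell interference at `z`. -/
noncomputable def interCell (α rhoU rhoB R : ℝ) (z : Plane) (x : ℕ → Plane)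
    (k : ℕ → CellGain) : ENNReal :=
  ∑' i, interTerm α rhoU rhoB R z (x i) (k i)

@[fun_prop]
lemma measurable_interTerm {β : Type*} [MeasurableSpace β] {α rhoU rhoB R : ℝ}
    {z x : β → Plane} {k : β → CellGain} (hz : Measurable z) (hx : Measurable x)
    (hk : Measurable k) : Measurable fun b => interTerm α rhoU rhoB R (z b) (x b) (k b) := by
  unfold interTerm
  fun_prop

@[fun_prop]
lemma measurable_interCell {β : Type*} [MeasurableSpace β] {α rhoU rhoB R : ℝ}
    {z : β → Plane} {x : β → ℕ → Plane} {k : β → ℕ → CellGain} (hz : Measurable z)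
    (hx : Measurable x) (hk : Measurable k) :
    Measurable fun b => interCell α rhoU rhoB R (z b) (x b) (k b) := by
  unfold interCell
  exact Measurable.tsum fun i => by fun_prop

/-! ### Reduction of the success probability -/

/-- The division-free form of the success event also agrees with the conventions for N = 0 and N =
∞. -/
lemma lt_mul_div_iff {θ b : ℝ} (hθ : 0 < θ) (hb : 0 < b) (g N : ENNReal) :
    ENNReal.ofReal θ < ENNReal.ofReal b * g / N ↔ ENNReal.ofReal (θ / b) * N < g := by
  have hθ' : ENNReal.ofReal θ ≠ 0 := by simpa using hθ
  have hb' : ENNReal.ofReal b ≠ 0 := by simpa using hb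
  rcases eq_or_ne N ⊤ with rfl | hN
  · rw [ENNReal.mul_top (by simpa using div_pos hθ hb)]
    by_cases hg : g = ⊤
    · simp [hg, ENNReal.mul_top hb']
    · simp [ENNReal.div_top]
  rw [ENNReal.lt_div_iff_mul_lt (Or.inr ENNReal.ofReal_ne_top) (Or.inl hN),
    ENNReal.ofReal_div_of_pos hb, div_eq_mul_inv, mul_right_comm, ← div_eq_mul_inv,
    ENNReal.div_lt_iff (Or.inl hb') (Or.inl ENNReal.ofReal_ne_top), mul_comm g]

end FDNetwork

namespace FDNetwork

open Set Filter Topology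

/-- The law of the locations of the other BSs, and of the marks of the typical and of the other
cells. -/
lemma IsNetwork.map_eq {Ω : Type*} [MeasurableSpace Ω] {P : Measure Ω} [IsProbabilityMeasure P]
    {lam : ℝ} {X : ℕ → Ω → Plane} {mark : Option ℕ → Ω → CellMark}
    (hnet : IsNetwork P lam X mark) :
    P.map (fun ω => ((fun i => X i ω), fun c => mark c ω))
      = ((P.map fun ω i => X i ω).prod
          (cellLaw.prod (Measure.infinitePi fun _ : ℕ => cellLaw))).map
          (Prod.map id fun p (c : Option ℕ) => c.elim p.1 p.2) := by
  have hX : Measurable fun ω i => X i ω := measurable_pi_lambda _ hnet.poisson.measurable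
  have hM : Measurable fun ω c => mark c ω := measurable_pi_lambda _ hnet.mark_measurable
  have := Measure.isProbabilityMeasure_map (μ := P) hX.aemeasurable
  rw [(indepFun_iff_map_prod_eq_prod_map_map hX.aemeasurable hM.aemeasurable).1 hnet.indep,
    (hnet.mark_indep.hasLaw_infinitePi hnet.mark_law hM.aemeasurable).map_eq,
    ← prod_infinitePi_map_elim, ← Measure.map_prod_map _ _ measurable_id, Measure.map_id]
  refine measurable_pi_lambda _ fun c => ?_
  cases c <;> simp only [Option.elim_none, Option.elim_some] <;> fun_prop

/-- Location of the typical DL node for given angles of the typical cell. -/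
noncomputable def dlNode (R : ℝ) (a : ℝ × ℝ) : Plane := pointAt 0 R a.2

/-- Received power of the intra-cell interference, without fading. -/
noncomputable def intraPower (α rhoU R : ℝ) (a : ℝ × ℝ) : ENNReal :=
  ENNReal.ofReal rhoU * pathLoss α (pointAt 0 R a.1) (dlNode R a)

@[fun_prop]
lemma measurable_dlNode {β : Type*} [MeasurableSpace β] {R : ℝ} {a : β → ℝ × ℝ}
    (ha : Measurable a) : Measurable fun b => dlNode R (a b) := by
  unfold dlNode
  fun_prop

@[fun_prop]
lemma measurable_intraPower {β : Type*} [MeasurableSpace β] {α rhoU R : ℝ} {a : β → ℝ × ℝ}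
    (ha : Measurable a) : Measurable fun b => intraPower α rhoU R (a b) := by
  unfold intraPower
  fun_prop

lemma IsNetwork.success_eq {Ω : Type*} [MeasurableSpace Ω] {P : Measure Ω}
    [IsProbabilityMeasure P] {lam : ℝ} {X : ℕ → Ω → Plane} {mark : Option ℕ → Ω → CellMark}
    (hnet : IsNetwork P lam X mark) {α rhoU rhoB R θ : ℝ} (hrhoB : 0 < rhoB) (hR : 0 < R)
    (hθ : 0 < θ) {W : Channel × Channel → Channel} (hW : Measurable W)
    (hunit : ∀ᵐ c ∂(rayleigh.prod rayleigh), ‖W c‖ = 1) :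
    P {ω | ENNReal.ofReal θ < sir α rhoU rhoB R R (fun i => X i ω) (fun c => mark c ω)
        (W (mark none ω).2)}
      = ∫⁻ a, ∫⁻ x, ∫⁻ k, (rayleigh.prod rayleigh) {c |
          ENNReal.ofReal (θ / (rhoB * R ^ (-α))) * (interCell α rhoU rhoB R (dlNode R a) x k
            + intraPower α rhoU R a * gain (W c) c.2) < gain (W c) c.1}
          ∂(Measure.infinitePi fun _ : ℕ => cellGainLaw) ∂(P.map fun ω i => X i ω)
          ∂(uniformAngle.prod uniformAngle) := by
  have hX : Measurable fun ω i => X i ω := measurable_pi_lambda _ hnet.poisson.measurable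
  have hM : Measurable fun ω c => mark c ω := measurable_pi_lambda _ hnet.mark_measurable
  have := Measure.isProbabilityMeasure_map (μ := P) hX.aemeasurable
  have hb : 0 < rhoB * R ^ (-α) := by positivity
  set s := ENNReal.ofReal (θ / (rhoB * R ^ (-α)))
  set D : Set ((ℕ → Plane) × (ℝ × ℝ) × (Channel × Channel) × (ℕ → CellGain)) :=
    {y | s * (interCell α rhoU rhoB R (dlNode R y.2.1) y.1 y.2.2.2
      + intraPower α rhoU R y.2.1 * gain (W y.2.2.1) y.2.2.1.2)
        < gain (W y.2.2.1) y.2.2.1.1} with hD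
  have hDm : MeasurableSet D := by
    refine measurableSet_lt ?_ ?_ <;> fun_prop
  have hG : Measurable fun y : (ℕ → Plane) × CellMark × (ℕ → CellMark) =>
      (y.1, y.2.1.1, y.2.1.2, fun i => cellGain (W y.2.1.2) (y.2.2 i)) := by
    fun_prop
  have hE : Measurable fun (p : CellMark × (ℕ → CellMark)) (c : Option ℕ) => c.elim p.1 p.2 := by
    refine measurable_pi_lambda _ fun c => ?_
    cases c <;> simp only [Option.elim_none, Option.elim_some] <;> fun_prop
  have hG' : Measurable fun y : (ℕ → Plane) × (Option ℕ → CellMark) =>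
      (y.1, (y.2 none).1, (y.2 none).2, fun i : ℕ => cellGain (W (y.2 none).2) (y.2 (some i))) :=
    hG.comp (by fun_prop : Measurable fun y : (ℕ → Plane) × (Option ℕ → CellMark) =>
      (y.1, y.2 none, fun i : ℕ => y.2 (some i)))
  have hevent : {ω | ENNReal.ofReal θ < sir α rhoU rhoB R R (fun i => X i ω) (fun c => mark c ω)
      (W (mark none ω).2)} = (fun ω => ((fun i => X i ω), fun c => mark c ω)) ⁻¹'
      ((fun y : (ℕ → Plane) × (Option ℕ → CellMark) =>
      (y.1, (y.2 none).1, (y.2 none).2, fun i : ℕ => cellGain (W (y.2 none).2) (y.2 (some i))))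
        ⁻¹' D) := by
    ext ω
    rw [mem_ofPred_eq, sir, ← ENNReal.ofReal_mul hrhoB.le, lt_mul_div_iff hθ hb]
    rfl
  rw [hevent, ← Measure.map_apply (hX.prodMk hM) (hG' hDm), hnet.map_eq,
    Measure.map_apply (measurable_id.prodMap hE) (hG' hDm)]
  have hDG := hG hDm
  calc _ = ((P.map fun ω i => X i ω).prod
          (cellLaw.prod (Measure.infinitePi fun _ : ℕ => cellLaw)))
          ((fun y : (ℕ → Plane) × CellMark × (ℕ → CellMark) =>
      (y.1, y.2.1.1, y.2.1.2, fun i => cellGain (W y.2.1.2) (y.2.2 i))) ⁻¹' D) := rfl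
    _ = ∫⁻ x, ∫⁻ m, (Measure.infinitePi fun _ : ℕ => cellLaw)
          {n | (x, m.1, m.2, fun i => cellGain (W m.2) (n i)) ∈ D} ∂cellLaw
          ∂(P.map fun ω i => X i ω) := by
        rw [Measure.prod_apply hDG]
        refine lintegral_congr fun x => ?_
        rw [Measure.prod_apply (measurable_prodMk_left hDG)]
        rfl
    _ = ∫⁻ x, ∫⁻ m, ∫⁻ k, D.indicator 1 (x, m.1, m.2, k)
          ∂(Measure.infinitePi fun _ : ℕ => cellGainLaw) ∂cellLaw
          ∂(P.map fun ω i => X i ω) := by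
        refine lintegral_congr fun x => lintegral_congr_ae ?_
        have h1 : ∀ᵐ m ∂cellLaw, ‖W m.2‖ = 1 := by
          have h2 : cellLaw.map Prod.snd = rayleigh.prod rayleigh := by
            rw [cellLaw, Measure.map_snd_prod]; simp
          rw [← h2] at hunit
          exact ae_of_ae_map measurable_snd.aemeasurable hunit
        filter_upwards [h1] with m hm
        have hcm : Measurable (cellGain (W m.2)) := by fun_prop
        -- For any fixed unit vector the gains from the other cells have the same law, so the choice
        -- of combiner no longer matters to them.
        have h3 : (Measure.infinitePi fun _ : ℕ => cellGainLaw)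
            = (Measure.infinitePi fun _ : ℕ => cellLaw).map
              (fun n i => cellGain (W m.2) (n i)) := by
          rw [Measure.infinitePi_map_pi (fun _ : ℕ => cellLaw) (fun _ => hcm),
            cellLaw_map_cellGain hm]
        have h4 : MeasurableSet {k : ℕ → CellGain | (x, m.1, m.2, k) ∈ D} :=
          hDm.preimage (by fun_prop : Measurable fun k : ℕ → CellGain => (x, m.1, m.2, k))
        have h5 : ∫⁻ k, D.indicator 1 (x, m.1, m.2, k)
            ∂(Measure.infinitePi fun _ : ℕ => cellGainLaw)
            = (Measure.infinitePi fun _ : ℕ => cellGainLaw) {k | (x, m.1, m.2, k) ∈ D} := by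
          rw [← lintegral_indicator_one h4]
          rfl
        rw [h5, h3, Measure.map_apply (by fun_prop) h4]
        rfl
    _ = ∫⁻ a, ∫⁻ x, ∫⁻ k, (rayleigh.prod rayleigh) {c | (x, a, c, k) ∈ D}
          ∂(Measure.infinitePi fun _ : ℕ => cellGainLaw) ∂(P.map fun ω i => X i ω)
          ∂(uniformAngle.prod uniformAngle) := by
        have hind : Measurable (D.indicator (M := ENNReal) 1) := measurable_one.indicator hDm
        clear_value D
        rw [cellLaw]
        refine (lintegral_prod_reorder (P.map fun ω i => X i ω) (uniformAngle.prod uniformAngle)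
          (rayleigh.prod rayleigh) (Measure.infinitePi fun _ : ℕ => cellGainLaw)
          (f := fun x b c k => D.indicator (M := ENNReal) 1 (x, b, c, k)) hind).trans ?_
        refine lintegral_congr fun a => lintegral_congr fun x => lintegral_congr fun k => ?_
        rw [← lintegral_indicator_one]
        · rfl
        · exact hDm.preimage (by fun_prop :
            Measurable fun c : Channel × Channel => (x, a, c, k))
    _ = _ := rfl

/-! ### Combining vectors -/

lemma norm_mrc {h : Channel} (hh : h ≠ 0) : ‖mrc h‖ = 1 := by
  rw [mrc, norm_smul, Complex.norm_real, norm_inv, norm_norm,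
    inv_mul_cancel₀ (norm_ne_zero_iff.2 hh)]

lemma gain_mrc (h : Channel) : gain (mrc h) h = ENNReal.ofReal (‖h‖ ^ 2) := by
  rw [gain, mrc, inner_smul_left, inner_self_eq_norm_sq_to_K, norm_mul]
  congr 2
  rcases eq_or_ne h 0 with rfl | hh
  · simp
  · have := norm_ne_zero_iff.2 hh
    simp
    field_simp

/-- A unit vector orthogonal to `q`. -/
noncomputable def perp (q : Channel) : Channel :=
  ((‖q‖⁻¹ : ℝ) : ℂ) • !₂[-(starRingEnd ℂ) (q 1), (starRingEnd ℂ) (q 0)]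

lemma norm_sq_eq_mul_conj (q : Channel) : ((‖q‖ ^ 2 : ℝ) : ℂ)
    = q 0 * (starRingEnd ℂ) (q 0) + q 1 * (starRingEnd ℂ) (q 1) := by
  rw [EuclideanSpace.norm_sq_eq, Fin.sum_univ_two, Complex.mul_conj, Complex.mul_conj,
    Complex.normSq_eq_norm_sq, Complex.normSq_eq_norm_sq]
  push_cast
  rfl

lemma norm_perp {q : Channel} (hq : q ≠ 0) : ‖perp q‖ = 1 := by
  have h1 : ‖(!₂[-(starRingEnd ℂ) (q 1), (starRingEnd ℂ) (q 0)] : Channel)‖ = ‖q‖ := by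
    rw [EuclideanSpace.norm_eq, EuclideanSpace.norm_eq, Fin.sum_univ_two, Fin.sum_univ_two]
    simp [add_comm]
  rw [perp, norm_smul, Complex.norm_real, norm_inv, norm_norm, h1,
    inv_mul_cancel₀ (norm_ne_zero_iff.2 hq)]

lemma inner_perp_self (q : Channel) : inner ℂ (perp q) q = 0 := by
  rw [perp, inner_smul_left, PiLp.inner_apply, Fin.sum_univ_two]
  simp
  right
  ring

/-- In ℂ² the orthogonal complement of a nonzero vector q is the line spanned by `perp q`. -/
lemma starProjection_orthogonal_eq_perp {q : Channel} (hq : q ≠ 0) (h : Channel) :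
    (Submodule.span ℂ {q})ᗮ.starProjection h = inner ℂ (perp q) h • perp q := by
  have hN : ((‖q‖ : ℝ) : ℂ) ≠ 0 := by simpa using hq
  have h1 := norm_sq_eq_mul_conj q
  push_cast at h1
  rw [Submodule.starProjection_orthogonal_val, Submodule.starProjection_singleton]
  ext i
  fin_cases i
  · simp [perp, PiLp.inner_apply, Fin.sum_univ_two]
    field_simp
    rw [h1]
    ring
  · simp [perp, PiLp.inner_apply, Fin.sum_univ_two]
    field_simp
    rw [h1]
    ring

lemma pzf_eq_perp {q : Channel} (hq : q ≠ 0) (h : Channel) :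
    pzf q h = (((‖inner ℂ (perp q) h‖⁻¹ : ℝ) : ℂ) * inner ℂ (perp q) h) • perp q := by
  rw [pzf, starProjection_orthogonal_eq_perp hq, norm_smul, norm_perp hq, mul_one, smul_smul]

lemma gain_smul (c : ℂ) (v h : Channel) :
    gain (c • v) h = ENNReal.ofReal (‖c‖ ^ 2) * gain v h := by
  rw [gain, gain, inner_smul_left, norm_mul, mul_pow, RCLike.norm_conj,
    ENNReal.ofReal_mul (by positivity)]

lemma gain_pzf_cancelled {q : Channel} (hq : q ≠ 0) (h : Channel) : gain (pzf q h) q = 0 := by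
  rw [pzf_eq_perp hq, gain_smul, gain, inner_perp_self]
  simp

/-- The PZF vector differs from `perp q` only by a scalar, of modulus one unless the projection
vanishes. As `perp q` does not depend on h, the gain is that of a fixed unit vector, hence
exponential. -/
lemma gain_pzf {q : Channel} (hq : q ≠ 0) (h : Channel) :
    gain (pzf q h) h = gain (perp q) h := by
  rw [pzf_eq_perp hq, gain_smul]
  by_cases h0 : inner ℂ (perp q) h = 0
  · simp [gain, h0]
  · have : ‖inner ℂ (perp q) h‖ ≠ 0 := norm_ne_zero_iff.2 h0
    rw [norm_mul, Complex.norm_real, norm_inv, norm_norm, inv_mul_cancel₀ this]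
    simp

lemma norm_pzf {q h : Channel} (hq : q ≠ 0) (h0 : gain (perp q) h ≠ 0) : ‖pzf q h‖ = 1 := by
  have h1 : ‖inner ℂ (perp q) h‖ ≠ 0 := by
    intro h
    simp [gain, h] at h0
  rw [pzf_eq_perp hq, norm_smul, norm_perp hq, mul_one, norm_mul, Complex.norm_real, norm_inv,
    norm_norm, inv_mul_cancel₀ h1]

lemma measurable_mrc : Measurable mrc := by
  unfold mrc
  fun_prop

lemma measurable_pzf : Measurable fun c : Channel × Channel => pzf c.2 c.1 := by
  unfold pzf
  simp_rw [Submodule.starProjection_orthogonal_val, Submodule.starProjection_singleton]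
  fun_prop

lemma ae_rayleigh_ne_zero : ∀ᵐ h ∂rayleigh, h ≠ 0 := by
  rw [ae_iff]
  simpa using rayleigh_singleton_zero

lemma ae_norm_mrc : ∀ᵐ c ∂(rayleigh.prod rayleigh), ‖mrc c.1‖ = 1 := by
  have h1 : ∀ᵐ c ∂(rayleigh.prod rayleigh), c.1 ≠ 0 :=
    Measure.quasiMeasurePreserving_fst.ae ae_rayleigh_ne_zero
  filter_upwards [h1] with c hc using norm_mrc hc

lemma ae_norm_pzf : ∀ᵐ c ∂(rayleigh.prod rayleigh), ‖pzf c.2 c.1‖ = 1 := by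
  have hm : MeasurableSet {c : Channel × Channel | ‖pzf c.2 c.1‖ = 1} :=
    measurableSet_eq_fun measurable_pzf.norm measurable_const
  -- The quantifiers are exchanged so that q, and with it `perp q`, is fixed first.
  rw [Measure.ae_prod_iff_ae_ae hm, Measure.ae_ae_comm hm]
  filter_upwards [ae_rayleigh_ne_zero] with q hq
  have h1 : ∀ᵐ e ∂gainLaw, e ≠ 0 := by
    rw [ae_iff]; simpa using gainLaw_singleton_zero
  rw [← rayleigh_map_gain (norm_perp hq)] at h1
  filter_upwards [ae_of_ae_map (by fun_prop) h1] with h hh using norm_pzf hq hh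

/-- The conditional success probability of PZF given the inter-cell interference. -/
lemma rayleigh_prod_pzf (s I c : ENNReal) :
    (rayleigh.prod rayleigh) {p : Channel × Channel |
      s * (I + c * gain (pzf p.2 p.1) p.2) < gain (pzf p.2 p.1) p.1} = expNeg (s * I) := by
  have hm := measurable_pzf
  have hms : MeasurableSet {p : Channel × Channel |
      s * (I + c * gain (pzf p.2 p.1) p.2) < gain (pzf p.2 p.1) p.1} := by
    refine measurableSet_lt ?_ ?_ <;> fun_prop
  rw [Measure.prod_apply_symm hms]
  have h1 : ∀ᵐ q ∂rayleigh, rayleigh ((fun h => (h, q)) ⁻¹' {p : Channel × Channel |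
      s * (I + c * gain (pzf p.2 p.1) p.2) < gain (pzf p.2 p.1) p.1}) = expNeg (s * I) := by
    filter_upwards [ae_rayleigh_ne_zero] with q hq
    rw [← gainLaw_Ioi, ← rayleigh_map_gain (norm_perp hq),
      Measure.map_apply (by fun_prop) measurableSet_Ioi]
    congr 1
    ext h
    simp [gain_pzf_cancelled hq, gain_pzf hq]
  rw [lintegral_congr_ae h1]
  simp

/-- The conditional success probability of MRC given the inter-cell interference. -/
lemma rayleigh_prod_mrc (s I c : ENNReal) :
    (rayleigh.prod rayleigh) {p : Channel × Channel |
      s * (I + c * gain (mrc p.1) p.2) < gain (mrc p.1) p.1}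
      = ∫⁻ e, (1 + s * (I + c * e)) * expNeg (s * (I + c * e)) ∂gainLaw := by
  have hm := measurable_mrc
  have hms : MeasurableSet {p : Channel × Channel |
      s * (I + c * gain (mrc p.1) p.2) < gain (mrc p.1) p.1} := by
    refine measurableSet_lt ?_ ?_ <;> fun_prop
  have hms' : MeasurableSet {p : Channel × ENNReal |
      s * (I + c * p.2) < ENNReal.ofReal (‖p.1‖ ^ 2)} := by
    refine measurableSet_lt ?_ ?_ <;> fun_prop
  rw [Measure.prod_apply hms]
  -- For fixed h the interfering gain is exponential whatever h is. After this replacement it is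
  -- fixed instead, and ‖h‖² is integrated out.
  have h1 : ∀ᵐ h ∂rayleigh, rayleigh (Prod.mk h ⁻¹' {p : Channel × Channel |
      s * (I + c * gain (mrc p.1) p.2) < gain (mrc p.1) p.1})
      = gainLaw (Prod.mk h ⁻¹' {p : Channel × ENNReal |
        s * (I + c * p.2) < ENNReal.ofReal (‖p.1‖ ^ 2)}) := by
    filter_upwards [ae_rayleigh_ne_zero] with h hh
    rw [← rayleigh_map_gain (norm_mrc hh),
      Measure.map_apply (by fun_prop) (measurable_prodMk_left hms')]
    simp only [gain_mrc]
    rfl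
  rw [lintegral_congr_ae h1, ← Measure.prod_apply hms', Measure.prod_apply_symm hms']
  refine lintegral_congr fun e => ?_
  rw [← rayleigh_map_norm_sq]
  rfl

end FDNetwork

namespace FDNetwork

open Set Filter Topology

/-! ### Laplace transform of the inter-cell interference -/

/-- The Laplace transform at `t` of the interference from the cell of a BS located at `x`. -/
noncomputable def cellLaplace (α rhoU rhoB R : ℝ) (t : ENNReal) (z x : Plane) : ENNReal :=
  ∫⁻ y, expNeg (t * interTerm α rhoU rhoB R z x y) ∂cellGainLaw

lemma cellLaplace_eq (α rhoU rhoB R : ℝ) (t : ENNReal) (z x : Plane) :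
    cellLaplace α rhoU rhoB R t z x
      = ∫⁻ φ, (1 + t * (ENNReal.ofReal rhoB * pathLoss α x z))⁻¹ *
          (1 + t * (ENNReal.ofReal rhoU * pathLoss α (pointAt x R φ) z))⁻¹ ∂uniformAngle := by
  rw [cellLaplace, cellGainLaw, lintegral_prod _ (by fun_prop)]
  refine lintegral_congr fun φ => ?_
  simp only [interTerm, mul_add, expNeg_add, ← mul_assoc]
  rw [lintegral_prod_mul (μ := gainLaw) (ν := gainLaw)
    (f := fun e => expNeg (t * ENNReal.ofReal rhoB * pathLoss α x z * e))
    (g := fun e => expNeg (t * ENNReal.ofReal rhoU * pathLoss α (pointAt x R φ) z * e))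
    (by fun_prop) (by fun_prop), lintegral_expNeg_mul_gainLaw, lintegral_expNeg_mul_gainLaw]

@[fun_prop]
lemma measurable_cellLaplace (α rhoU rhoB R : ℝ) (t : ENNReal) (z : Plane) :
    Measurable fun x => cellLaplace α rhoU rhoB R t z x := by
  unfold cellLaplace
  exact Measurable.lintegral_prod_right (by fun_prop)

lemma cellLaplace_le_one (α rhoU rhoB R : ℝ) (t : ENNReal) (z x : Plane) :
    cellLaplace α rhoU rhoB R t z x ≤ 1 := by
  simpa [cellLaplace] using lintegral_mono (μ := cellGainLaw)
    fun y => expNeg_le_one (t * interTerm α rhoU rhoB R z x y)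

lemma pathLoss_sub_right (α : ℝ) (x z : Plane) : pathLoss α x z = pathLoss α (x - z) 0 := by
  rw [pathLoss_eq_enorm, pathLoss_eq_enorm, sub_zero]

lemma cellLaplace_sub (α rhoU rhoB R : ℝ) (t : ENNReal) (z x : Plane) :
    cellLaplace α rhoU rhoB R t z x = cellLaplace α rhoU rhoB R t 0 (x - z) := by
  rw [cellLaplace_eq, cellLaplace_eq]
  refine lintegral_congr fun φ => ?_
  rw [pathLoss_sub_right α x z, pathLoss_sub_right α (pointAt x R φ) z,
    show pointAt x R φ - z = pointAt (x - z) R φ by unfold pointAt; abel]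

/-- The exponent of the Laplace transform of the inter-cell interference. -/
noncomputable def interExponent (lam α rhoU rhoB R : ℝ) (t : ENNReal) : ENNReal :=
  ENNReal.ofReal lam * ∫⁻ x : Plane, (1 - cellLaplace α rhoU rhoB R t 0 x)

lemma lintegral_expNeg_interCell {Ω : Type*} [MeasurableSpace Ω] {P : Measure Ω}
    [IsProbabilityMeasure P] {lam : ℝ} {X : ℕ → Ω → Plane}
    (h : IsPoissonPointProcess P (ENNReal.ofReal lam • (volume : Measure Plane)) X)
    (α rhoU rhoB R : ℝ) (t : ENNReal) (z : Plane) :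
    ∫⁻ x, ∫⁻ k, expNeg (t * interCell α rhoU rhoB R z x k)
        ∂(Measure.infinitePi fun _ : ℕ => cellGainLaw) ∂(P.map fun ω i => X i ω)
      = expNeg (interExponent lam α rhoU rhoB R t) := by
  have hX : Measurable fun ω i => X i ω := measurable_pi_lambda _ h.measurable
  have h1 (x : ℕ → Plane) : ∫⁻ k, expNeg (t * interCell α rhoU rhoB R z x k)
      ∂(Measure.infinitePi fun _ : ℕ => cellGainLaw)
      = expNeg (∑' i, negLog (cellLaplace α rhoU rhoB R t z (x i))) := by
    simp only [interCell, ← ENNReal.tsum_mul_left]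
    exact lintegral_infinitePi_expNeg_tsum cellGainLaw
      (h := fun i k => t * interTerm α rhoU rhoB R z (x i) k) (fun i => by fun_prop)
  have hm : Measurable fun x : ℕ → Plane =>
      expNeg (∑' i, negLog (cellLaplace α rhoU rhoB R t z (x i))) :=
    measurable_expNeg.comp (Measurable.tsum fun i =>
      measurable_negLog.comp ((measurable_cellLaplace α rhoU rhoB R t z).comp
        (measurable_pi_apply i)))
  have hσ : SigmaFinite (ENNReal.ofReal lam • (volume : Measure Plane)) :=
    SMul.sigmaFinite (Real.toNNReal lam)
  simp_rw [h1]
  rw [lintegral_map hm hX, h.lintegral_expNeg_tsum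
    (f := fun x => negLog (cellLaplace α rhoU rhoB R t z x)) (by fun_prop)]
  simp_rw [expNeg_negLog (cellLaplace_le_one _ _ _ _ _ _ _)]
  -- Shifting the integration variable by z shows that the exponent does not depend on the
  -- receiver's position.
  rw [lintegral_smul_measure, interExponent, smul_eq_mul,
    ← lintegral_sub_right_eq_self (fun x : Plane => 1 - cellLaplace α rhoU rhoB R t 0 x) z]
  simp_rw [← cellLaplace_sub]

lemma pointAt_eq_add (x : Plane) (r φ : ℝ) : pointAt x r φ = x + pointAt 0 r φ := by
  simp [pointAt]

lemma one_sub_mul_le {p q : ENNReal} (hp : p ≤ 1) (hq : q ≤ 1) :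
    1 - p * q ≤ (1 - p) + (1 - q) := by
  rw [tsub_le_iff_left]
  calc (1 : ENNReal) = p + (1 - p) := (add_tsub_cancel_of_le hp).symm
    _ = p * (q + (1 - q)) + (1 - p) := by rw [add_tsub_cancel_of_le hq, mul_one]
    _ ≤ p * q + ((1 - p) + (1 - q)) := by
        rw [mul_add, add_assoc, add_comm (p * (1 - q))]
        gcongr
        exact mul_le_of_le_one_left' hp

lemma inv_one_add_le_one (a : ENNReal) : (1 + a)⁻¹ ≤ 1 :=
  ENNReal.inv_le_one.2 le_self_add

/-- The bound 1 - pq ≤ (1 - p) + (1 - q) separates the BS from its UL node. Finiteness makes L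
positive, which the final strict inequality needs. -/
lemma interExponent_ne_top {lam α rhoU rhoB R τ : ℝ} (hα : 2 < α) (hU : 0 < rhoU)
    (hB : 0 < rhoB) (hτ : 0 < τ) :
    interExponent lam α rhoU rhoB R (ENNReal.ofReal τ) ≠ ⊤ := by
  refine ENNReal.mul_ne_top ENNReal.ofReal_ne_top ?_
  set f : Plane → ℝ → ENNReal := fun x φ =>
    (1 - (1 + ENNReal.ofReal (τ * rhoB) * pathLoss α (x + 0) 0)⁻¹)
      + (1 - (1 + ENNReal.ofReal (τ * rhoU) * pathLoss α (x + pointAt 0 R φ) 0)⁻¹) with hf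
  have hle (x : Plane) : 1 - cellLaplace α rhoU rhoB R (ENNReal.ofReal τ) 0 x
      ≤ ∫⁻ φ, f x φ ∂uniformAngle := by
    rw [tsub_le_iff_left, cellLaplace_eq, ← lintegral_add_left (by fun_prop)]
    have h1 : (1 : ENNReal) = ∫⁻ _, 1 ∂uniformAngle := by simp
    conv_lhs => rw [h1]
    refine lintegral_mono fun φ => ?_
    simp only [hf]
    rw [← tsub_le_iff_left, ENNReal.ofReal_mul hτ.le, ENNReal.ofReal_mul hτ.le, mul_assoc,
      mul_assoc, add_zero, ← pointAt_eq_add]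
    exact one_sub_mul_le (inv_one_add_le_one _) (inv_one_add_le_one _)
  refine ((lintegral_mono hle).trans_lt ?_).ne
  rw [lintegral_lintegral_swap (by
    refine Measurable.aemeasurable ?_
    simp only [hf]
    fun_prop)]
  have h2 (φ : ℝ) : ∫⁻ x, f x φ
      = (∫⁻ x : Plane, (1 - (1 + ENNReal.ofReal (τ * rhoB) * pathLoss α (x + 0) 0)⁻¹))
        + ∫⁻ x : Plane, (1 - (1 + ENNReal.ofReal (τ * rhoU) * pathLoss α (x + 0) 0)⁻¹) := by
    rw [hf, lintegral_add_left (by fun_prop),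
      lintegral_pathLoss_comp α 0 (pointAt 0 R φ)
        (fun p => 1 - (1 + ENNReal.ofReal (τ * rhoU) * p)⁻¹),
      lintegral_pathLoss_comp α 0 0 (fun p => 1 - (1 + ENNReal.ofReal (τ * rhoU) * p)⁻¹)]
  simp_rw [h2]
  rw [lintegral_const, measure_univ, mul_one]
  exact ENNReal.add_lt_top.2
    ⟨(lintegral_one_sub_inv_pathLoss_ne_top hα (by positivity) _ _).lt_top,
      (lintegral_one_sub_inv_pathLoss_ne_top hα (by positivity) _ _).lt_top⟩

/-! ### Bounding E[τI exp(-τI)] by difference quotients -/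

/-- The first-order term at ρ = 1 is (1 - ρ) A / (1 + A)². By convexity in ρ it underestimates the
increase, and the extra factor 1/ρ absorbs the second-order error. -/
lemma inv_one_add_mul_le {ρ : ℝ} (h0 : 0 < ρ) (h1 : ρ ≤ 1) (A : ENNReal) :
    (1 + ENNReal.ofReal ρ * A)⁻¹
      ≤ (1 + A)⁻¹ + ENNReal.ofReal ((1 - ρ) / ρ) * (A * ((1 + A)⁻¹) ^ 2) := by
  induction A with
  | top => rw [ENNReal.mul_top (by simpa using h0)]; simp
  | coe a =>
    have ha := a.coe_nonneg
    have h2 : (0 : ℝ) ≤ (1 - ρ) / ρ := div_nonneg (by linarith) h0.le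
    rw [← ENNReal.ofReal_coe_nnreal, ← ENNReal.ofReal_mul h0.le, ← ENNReal.ofReal_one,
      ← ENNReal.ofReal_add zero_le_one (by positivity), ← ENNReal.ofReal_add zero_le_one ha,
      ← ENNReal.ofReal_inv_of_pos (by positivity), ← ENNReal.ofReal_inv_of_pos (by positivity),
      ← ENNReal.ofReal_pow (by positivity), ← ENNReal.ofReal_mul ha, ← ENNReal.ofReal_mul h2,
      ← ENNReal.ofReal_add (by positivity) (by positivity)]
    refine ENNReal.ofReal_le_ofReal ?_
    have h3 : (0 : ℝ) < 1 + ρ * a := by positivity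
    have h4 : (0 : ℝ) < 1 + (a : ℝ) := by positivity
    have h5 : (1 + (a : ℝ))⁻¹ + (1 - ρ) / ρ * (a * ((1 + (a : ℝ))⁻¹) ^ 2) - (1 + ρ * a)⁻¹
        = (1 - ρ) ^ 2 * a / (ρ * (1 + a) ^ 2 * (1 + ρ * a)) := by
      field_simp
      ring
    have h6 : 0 ≤ (1 - ρ) ^ 2 * a / (ρ * (1 + a) ^ 2 * (1 + ρ * a)) := by positivity
    linarith

lemma mul_le_mul_add_of_le {p q p' q' a b : ENNReal} (hp : p ≤ 1) (hq' : q' ≤ 1)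
    (h1 : p' ≤ p + a) (h2 : q' ≤ q + b) : p' * q' ≤ p * q + (a + b) :=
  calc p' * q' ≤ (p + a) * q' := by gcongr
    _ = p * q' + a * q' := add_mul _ _ _
    _ ≤ p * (q + b) + a * 1 := by gcongr
    _ = p * q + (p * b + a) := by ring
    _ ≤ p * q + (a + b) := by
        rw [add_comm a b]
        gcongr
        exact mul_le_of_le_one_left' hp

/-- Scaling τ by ρ changes the BS and UL factors of a cell separately. In each change the other
factor is bounded by 1, so the plane integrals decouple although both nodes belong to one cell. -/
lemma interExponent_le {lam α rhoU rhoB R τ ρ : ℝ} (hα : 2 < α) (hlam : 0 < lam) (hU : 0 < rhoU)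
    (hB : 0 < rhoB) (hτ : 0 < τ) (h0 : 0 < ρ) (h1 : ρ ≤ 1) :
    interExponent lam α rhoU rhoB R (ENNReal.ofReal τ)
      ≤ interExponent lam α rhoU rhoB R (ENNReal.ofReal (ρ * τ)) + ENNReal.ofReal ((1 - ρ) / ρ *
        (lam * (spatialConst α (τ * rhoB) + spatialConst α (τ * rhoU)))) := by
  have hη : (0 : ℝ) ≤ (1 - ρ) / ρ := div_nonneg (by linarith) h0.le
  have hcB := spatialConst_nonneg hα (mul_pos hτ hB)
  have hcU := spatialConst_nonneg hα (mul_pos hτ hU)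
  set f : Plane → ℝ → ENNReal := fun x φ =>
    ENNReal.ofReal (τ * rhoB) * pathLoss α (x + 0) 0 *
        ((1 + ENNReal.ofReal (τ * rhoB) * pathLoss α (x + 0) 0)⁻¹) ^ 2
      + ENNReal.ofReal (τ * rhoU) * pathLoss α (x + pointAt 0 R φ) 0 *
        ((1 + ENNReal.ofReal (τ * rhoU) * pathLoss α (x + pointAt 0 R φ) 0)⁻¹) ^ 2 with hf
  have hfm : Measurable fun p : Plane × ℝ => f p.1 p.2 := by
    simp only [hf]
    fun_prop
  have hle (x : Plane) : 1 - cellLaplace α rhoU rhoB R (ENNReal.ofReal τ) 0 x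
      ≤ (1 - cellLaplace α rhoU rhoB R (ENNReal.ofReal (ρ * τ)) 0 x)
        + ENNReal.ofReal ((1 - ρ) / ρ) * ∫⁻ φ, f x φ ∂uniformAngle := by
    refine tsub_le_tsub_add_tsub.trans (add_le_add_right (tsub_le_iff_left.2 ?_) _)
    rw [cellLaplace_eq, cellLaplace_eq, ← lintegral_const_mul _ (by fun_prop),
      ← lintegral_add_left (by fun_prop)]
    refine lintegral_mono fun φ => ?_
    simp only [hf]
    rw [add_zero, ← pointAt_eq_add, mul_add, ENNReal.ofReal_mul hτ.le, ENNReal.ofReal_mul hτ.le,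
      ENNReal.ofReal_mul h0.le]
    simp only [mul_assoc]
    have h2 := inv_one_add_mul_le h0 h1 (ENNReal.ofReal τ * (ENNReal.ofReal rhoB * pathLoss α x 0))
    have h3 := inv_one_add_mul_le h0 h1
      (ENNReal.ofReal τ * (ENNReal.ofReal rhoU * pathLoss α (pointAt x R φ) 0))
    simp only [mul_assoc] at h2 h3
    exact mul_le_mul_add_of_le (inv_one_add_le_one _) (inv_one_add_le_one _) h2 h3
  have hint : ∫⁻ x : Plane, ∫⁻ φ, f x φ ∂uniformAngle
      = ENNReal.ofReal (spatialConst α (τ * rhoB) + spatialConst α (τ * rhoU)) := by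
    rw [lintegral_lintegral_swap hfm.aemeasurable]
    have h2 (φ : ℝ) : ∫⁻ x, f x φ
        = ENNReal.ofReal (spatialConst α (τ * rhoB) + spatialConst α (τ * rhoU)) := by
      simp only [hf]
      rw [lintegral_add_left (by fun_prop), lintegral_pathLoss_ratio hα (by positivity),
        lintegral_pathLoss_ratio hα (by positivity), ENNReal.ofReal_add hcB hcU]
    simp_rw [h2]
    rw [lintegral_const, measure_univ, mul_one]
  calc _ ≤ ENNReal.ofReal lam * ∫⁻ x : Plane,
        ((1 - cellLaplace α rhoU rhoB R (ENNReal.ofReal (ρ * τ)) 0 x)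
        + ENNReal.ofReal ((1 - ρ) / ρ) * ∫⁻ φ, f x φ ∂uniformAngle) := by
        unfold interExponent
        gcongr with x
        exact hle x
    _ = _ := by
        rw [lintegral_add_left (by fun_prop),
          lintegral_const_mul _ (Measurable.lintegral_prod_right hfm), hint, mul_add,
          interExponent, ENNReal.ofReal_mul hη, ENNReal.ofReal_mul hlam.le]
        ring

/-- This is 1 + εt ≤ exp(εt) multiplied by exp(-t). Integrated, it bounds E[t exp(-t)] by a
difference quotient of the Laplace transform. -/
lemma mul_expNeg_add_le {ε : ℝ} (h0 : 0 < ε) (h1 : ε < 1) (t : ENNReal) :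
    ENNReal.ofReal ε * (t * expNeg t) + expNeg t ≤ expNeg (ENNReal.ofReal (1 - ε) * t) := by
  induction t with
  | top => simp [expNeg_top]
  | coe a =>
    have ha := a.coe_nonneg
    rw [← ENNReal.ofReal_coe_nnreal, ← ENNReal.ofReal_mul (by linarith), expNeg_ofReal ha,
      expNeg_ofReal (mul_nonneg (by linarith) ha), ← ENNReal.ofReal_mul ha,
      ← ENNReal.ofReal_mul h0.le, ← ENNReal.ofReal_add (by positivity) (by positivity)]
    refine ENNReal.ofReal_le_ofReal ?_
    have h2 : Real.exp (-((1 - ε) * a)) = Real.exp (ε * a) * Real.exp (-a) := by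
      rw [← Real.exp_add]
      ring_nf
    rw [h2]
    nlinarith [Real.add_one_le_exp (ε * a), Real.exp_pos (-(a : ℝ))]

/-- From exp(x) - 1 ≤ x exp(x), division by ε and the limit ε → 0+. -/
lemma le_mul_of_forall_exp {M l T : ℝ} (hl : 0 ≤ l)
    (h : ∀ ε : ℝ, 0 < ε → ε < 1 → ε * M + l ≤ l * Real.exp (ε / (1 - ε) * T)) : M ≤ l * T := by
  have h1 : ∀ ε : ℝ, 0 < ε → ε < 1 → M ≤ l * (T / (1 - ε) * Real.exp (ε / (1 - ε) * T)) := by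
    intro ε h0 h1
    have h2 := Real.add_one_le_exp (-(ε / (1 - ε) * T))
    have h3 : Real.exp (ε / (1 - ε) * T) - 1
        ≤ (ε / (1 - ε) * T) * Real.exp (ε / (1 - ε) * T) := by
      have h4 := mul_le_mul_of_nonneg_right h2 (Real.exp_pos (ε / (1 - ε) * T)).le
      rw [← Real.exp_add, neg_add_cancel, Real.exp_zero] at h4
      linarith
    have h5 := h ε h0 h1
    have h6 := mul_le_mul_of_nonneg_left h3 hl
    have h7 : ε * M ≤ ε * (l * (T / (1 - ε) * Real.exp (ε / (1 - ε) * T))) := by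
      calc ε * M ≤ l * (Real.exp (ε / (1 - ε) * T) - 1) := by linarith
        _ ≤ l * ((ε / (1 - ε) * T) * Real.exp (ε / (1 - ε) * T)) := h6
        _ = _ := by ring
    exact le_of_mul_le_mul_left h7 h0
  have hc : ContinuousAt (fun ε : ℝ => l * (T / (1 - ε) * Real.exp (ε / (1 - ε) * T))) 0 := by
    have h2 : (1 : ℝ) - 0 ≠ 0 := by norm_num
    fun_prop (disch := exact h2)
  have hlim : Tendsto (fun ε : ℝ => l * (T / (1 - ε) * Real.exp (ε / (1 - ε) * T))) (𝓝[>] 0)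
      (𝓝 (l * T)) := by
    have := hc.tendsto.mono_left (nhdsWithin_le_nhds (s := Ioi 0))
    simpa using this
  refine ge_of_tendsto hlim ?_
  filter_upwards [Ioo_mem_nhdsGT (show (0 : ℝ) < 1 by norm_num)] with ε hε
  exact h1 ε hε.1 hε.2

lemma lintegral_mul_expNeg_interCell_le {Ω : Type*} [MeasurableSpace Ω] {P : Measure Ω}
    [IsProbabilityMeasure P] {lam : ℝ} {X : ℕ → Ω → Plane}
    (h : IsPoissonPointProcess P (ENNReal.ofReal lam • (volume : Measure Plane)) X)
    {α rhoU rhoB τ : ℝ} (R : ℝ) (hα : 2 < α) (hlam : 0 < lam) (hU : 0 < rhoU)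
    (hB : 0 < rhoB) (hτ : 0 < τ) (z : Plane) :
    ∫⁻ x, ∫⁻ k, ENNReal.ofReal τ * interCell α rhoU rhoB R z x k *
        expNeg (ENNReal.ofReal τ * interCell α rhoU rhoB R z x k)
        ∂(Measure.infinitePi fun _ : ℕ => cellGainLaw) ∂(P.map fun ω i => X i ω)
      ≤ expNeg (interExponent lam α rhoU rhoB R (ENNReal.ofReal τ)) *
        ENNReal.ofReal (lam * (spatialConst α (τ * rhoB) + spatialConst α (τ * rhoU))) := by
  have hcB := spatialConst_nonneg hα (mul_pos hτ hB)
  have hcU := spatialConst_nonneg hα (mul_pos hτ hU)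
  set T := lam * (spatialConst α (τ * rhoB) + spatialConst α (τ * rhoU)) with hT
  have hT0 : 0 ≤ T := by positivity
  set L := expNeg (interExponent lam α rhoU rhoB R (ENNReal.ofReal τ)) with hL
  set Q := Measure.infinitePi fun _ : ℕ => cellGainLaw
  set M := ∫⁻ x, ∫⁻ k, ENNReal.ofReal τ * interCell α rhoU rhoB R z x k *
        expNeg (ENNReal.ofReal τ * interCell α rhoU rhoB R z x k) ∂Q ∂(P.map fun ω i => X i ω)
    with hM
  have hmain : ∀ ε : ℝ, 0 < ε → ε < 1 →
      ENNReal.ofReal ε * M + L ≤ L * ENNReal.ofReal (Real.exp (ε / (1 - ε) * T)) := by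
    intro ε h0 h1
    have hε : 0 ≤ ε / (1 - ε) * T := mul_nonneg (div_nonneg h0.le (by linarith)) hT0
    have h2 : ENNReal.ofReal ε * M + L
        ≤ expNeg (interExponent lam α rhoU rhoB R (ENNReal.ofReal ((1 - ε) * τ))) := by
      rw [hL, ← lintegral_expNeg_interCell h α rhoU rhoB R _ z,
        ← lintegral_expNeg_interCell h α rhoU rhoB R _ z, hM,
        ← lintegral_const_mul _ (Measurable.lintegral_prod_right (by fun_prop)),
        ← lintegral_add_left (Measurable.const_mul (Measurable.lintegral_prod_right
          (by fun_prop)) _)]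
      refine lintegral_mono fun x => ?_
      rw [← lintegral_const_mul _ (by fun_prop), ← lintegral_add_left (by fun_prop)]
      refine lintegral_mono fun k => ?_
      rw [ENNReal.ofReal_mul (show 0 ≤ 1 - ε by linarith), mul_assoc (ENNReal.ofReal (1 - ε))]
      exact mul_expNeg_add_le h0 h1 _
    have h3 := interExponent_le (R := R) hα hlam hU hB hτ (show 0 < 1 - ε by linarith)
      (by linarith)
    rw [sub_sub_cancel] at h3
    have h4 := antitone_expNeg h3
    rw [expNeg_add, expNeg_ofReal hε, Real.exp_neg,
      ENNReal.ofReal_inv_of_pos (Real.exp_pos _), ← div_eq_mul_inv] at h4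
    refine h2.trans ?_
    rwa [ENNReal.div_le_iff (by simpa using Real.exp_pos _) ENNReal.ofReal_ne_top] at h4
  have hLtop : L ≠ ⊤ := expNeg_ne_top _
  -- A single value of ε already forces M to be finite, so the limit can be taken in the reals.
  have hMtop : M ≠ ⊤ := by
    intro hMt
    have h2 := hmain (1 / 2) (by norm_num) (by norm_num)
    rw [hMt, ENNReal.mul_top (by simp), top_add, top_le_iff] at h2
    exact ENNReal.mul_ne_top hLtop ENNReal.ofReal_ne_top h2
  have hreal := le_mul_of_forall_exp (M := M.toReal) (l := L.toReal) (T := T)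
    ENNReal.toReal_nonneg fun ε h0 h1 => by
      have h2 := ENNReal.toReal_mono (ENNReal.mul_ne_top hLtop ENNReal.ofReal_ne_top)
        (hmain ε h0 h1)
      rwa [ENNReal.toReal_add (ENNReal.mul_ne_top ENNReal.ofReal_ne_top hMtop) hLtop,
        ENNReal.toReal_mul, ENNReal.toReal_mul, ENNReal.toReal_ofReal h0.le,
        ENNReal.toReal_ofReal (Real.exp_pos _).le] at h2
  rw [← ENNReal.ofReal_toReal hMtop, ← ENNReal.ofReal_toReal hLtop,
    ← ENNReal.ofReal_mul ENNReal.toReal_nonneg]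
  exact ENNReal.ofReal_le_ofReal hreal

end FDNetwork

namespace FDNetwork

open Set Filter Topology

/-! ### The intra-cell link -/

lemma integral_cos_uniformAngle : ∫ x, Real.cos x ∂uniformAngle = 0 := by
  rw [uniformAngle, ProbabilityTheory.cond, integral_smul_measure, integral_Icc_eq_integral_Ioc,
    ← intervalIntegral.integral_of_le (by positivity), integral_cos]
  simp

lemma integral_sin_uniformAngle : ∫ x, Real.sin x ∂uniformAngle = 0 := by
  rw [uniformAngle, ProbabilityTheory.cond, integral_smul_measure, integral_Icc_eq_integral_Ioc,
    ← intervalIntegral.integral_of_le (by positivity), integral_sin]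
  simp

lemma integral_cos_sub_uniformAngle :
    ∫ a, Real.cos (a.1 - a.2) ∂(uniformAngle.prod uniformAngle) = 0 := by
  have hi {f g : ℝ → ℝ} (hf : Continuous f) (hg : Continuous g) (hf1 : ∀ x, |f x| ≤ 1)
      (hg1 : ∀ x, |g x| ≤ 1) :
      Integrable (fun a : ℝ × ℝ => f a.1 * g a.2) (uniformAngle.prod uniformAngle) := by
    refine Integrable.of_bound (by fun_prop) 1 (.of_forall fun a => ?_)
    rw [Real.norm_eq_abs, abs_mul]
    exact mul_le_one₀ (hf1 _) (abs_nonneg _) (hg1 _)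
  simp_rw [Real.cos_sub]
  rw [integral_add (hi Real.continuous_cos Real.continuous_cos Real.abs_cos_le_one
      Real.abs_cos_le_one) (hi Real.continuous_sin Real.continuous_sin Real.abs_sin_le_one
      Real.abs_sin_le_one),
    integral_prod_mul (μ := uniformAngle) (ν := uniformAngle) Real.cos Real.cos,
    integral_prod_mul (μ := uniformAngle) (ν := uniformAngle) Real.sin Real.sin,
    integral_cos_uniformAngle, integral_sin_uniformAngle]
  simp

/-- The squared distance of the UL and the DL node of a cell, as a fraction of its maximum. -/
noncomputable def sqChord (a : ℝ × ℝ) : ℝ := (1 - Real.cos (a.1 - a.2)) / 2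

lemma sqChord_nonneg (a : ℝ × ℝ) : 0 ≤ sqChord a := by
  have := Real.cos_le_one (a.1 - a.2)
  unfold sqChord
  linarith

lemma sqChord_le_one (a : ℝ × ℝ) : sqChord a ≤ 1 := by
  have := Real.neg_one_le_cos (a.1 - a.2)
  unfold sqChord
  linarith

lemma edist_pointAt_zero {R : ℝ} (hR : 0 < R) (a : ℝ × ℝ) :
    edist (pointAt 0 R a.1) (pointAt 0 R a.2)
      = ENNReal.ofReal (2 * R * Real.sqrt (sqChord a)) := by
  rw [edist_dist, EuclideanSpace.dist_eq, Fin.sum_univ_two]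
  congr 1
  have h : 2 * R = Real.sqrt ((2 * R) ^ 2) := (Real.sqrt_sq (by positivity)).symm
  rw [h, ← Real.sqrt_mul (by positivity), Real.dist_eq, Real.dist_eq, sq_abs, sq_abs, sqChord,
    Real.cos_sub]
  congr 1
  simp [pointAt]
  linear_combination R ^ 2 * Real.sin_sq_add_cos_sq a.1 + R ^ 2 * Real.sin_sq_add_cos_sq a.2

lemma div_sqChord_le_intraPower {α rhoU R τ : ℝ} (hα : 2 < α) (hU : 0 < rhoU) (hR : 0 < R)
    (hτ : 0 < τ) (a : ℝ × ℝ) :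
    ENNReal.ofReal (τ * rhoU * (2 * R) ^ (-α)) / ENNReal.ofReal (sqChord a)
      ≤ ENNReal.ofReal τ * intraPower α rhoU R a := by
  rw [intraPower, dlNode, pathLoss, edist_pointAt_zero hR]
  rcases (sqChord_nonneg a).eq_or_lt with h0 | h0
  · rw [← h0, Real.sqrt_zero, mul_zero, ENNReal.ofReal_zero,
      ENNReal.zero_rpow_of_neg (by linarith), ENNReal.mul_top (by simpa using hU),
      ENNReal.mul_top (by simpa using hτ)]
    exact le_top
  · have hs := Real.sqrt_pos.2 h0
    rw [ENNReal.ofReal_rpow_of_pos (by positivity), ← ENNReal.ofReal_mul hU.le,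
      ← ENNReal.ofReal_mul hτ.le, ← ENNReal.ofReal_div_of_pos h0]
    refine ENNReal.ofReal_le_ofReal ?_
    rw [Real.mul_rpow (by positivity) hs.le, div_eq_mul_inv]
    -- Here y ≤ 1 and α/2 ≥ 1, so y^(-α/2) ≥ y^(-1).
    have h1 : (sqChord a)⁻¹ ≤ Real.sqrt (sqChord a) ^ (-α) := by
      rw [Real.sqrt_eq_rpow, ← Real.rpow_mul h0.le, ← Real.rpow_neg_one]
      exact Real.rpow_le_rpow_of_exponent_ge h0 (sqChord_le_one a) (by linarith)
    calc _ ≤ τ * rhoU * (2 * R) ^ (-α) * Real.sqrt (sqChord a) ^ (-α) := by gcongr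
      _ = _ := by ring

/-- The tangent at `y = 1 / 2` of the concave function `(2 + T) p - p ^ 2`, `p = y / (y + a)`. -/
noncomputable def tangent (a T y : ℝ) : ℝ :=
  1 - a ^ 2 / (1 / 2 + a) ^ 2 + T * (1 - a / (1 / 2 + a))
    + (y - 1 / 2) * (2 * a ^ 2 / (1 / 2 + a) ^ 3 + T * a / (1 / 2 + a) ^ 2)

/-- The quadratic in p increases up to p = 1, so p may be replaced by q = y / (y + a). As q = 1 - a
/ (y + a), the value is 1 - (1 - q)² + T q, and convexity of 1/x and 1/x² supplies the tangent
bound. -/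
lemma le_tangent {a T y p : ℝ} (ha : 0 < a) (hT : 0 ≤ T) (hy : 0 ≤ y) (hp : p ≤ y / (y + a)) :
    (2 + T) * p - p ^ 2 ≤ tangent a T y := by
  obtain ⟨d, hd⟩ : ∃ d, y = 1 / 2 + d := ⟨y - 1 / 2, by ring⟩
  obtain ⟨b, hb⟩ : ∃ b, b = 1 / 2 + a := ⟨_, rfl⟩
  have hb0 : 0 < b := by linarith
  have hbd : 0 < b + d := by linarith
  have hya : y + a = b + d := by linarith
  have h1 : 1 / b - d / b ^ 2 ≤ 1 / (b + d) := by
    have : 1 / (b + d) - (1 / b - d / b ^ 2) = d ^ 2 / (b ^ 2 * (b + d)) := by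
      field_simp
      ring
    have : 0 ≤ d ^ 2 / (b ^ 2 * (b + d)) := by positivity
    linarith
  have h2 : 1 / b ^ 2 - 2 * d / b ^ 3 ≤ 1 / (b + d) ^ 2 := by
    have h3 : 1 / (b + d) ^ 2 - (1 / b ^ 2 - 2 * d / b ^ 3)
        = d ^ 2 * (b + 2 * (b + d)) / (b ^ 3 * (b + d) ^ 2) := by
      field_simp
      ring
    have : 0 ≤ d ^ 2 * (b + 2 * (b + d)) / (b ^ 3 * (b + d) ^ 2) := by positivity
    linarith
  have hq1 : y / (y + a) ≤ 1 := by rw [div_le_one (by linarith)]; linarith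
  calc (2 + T) * p - p ^ 2 ≤ (2 + T) * (y / (y + a)) - (y / (y + a)) ^ 2 := by
        nlinarith [mul_nonneg (sub_nonneg.2 hp) hT]
    _ = 1 - a ^ 2 * (1 / (b + d) ^ 2) + T * (1 - a * (1 / (b + d))) := by
        rw [hya, show y = b + d - a by linarith]
        field_simp
        ring
    _ ≤ 1 - a ^ 2 * (1 / b ^ 2 - 2 * d / b ^ 3) + T * (1 - a * (1 / b - d / b ^ 2)) := by
        gcongr
    _ = tangent a T y := by
        rw [tangent, ← hb, hd]
        ring

lemma tangent_nonneg {a T y : ℝ} (ha : 0 < a) (hT : 0 ≤ T) (hy : 0 ≤ y) : 0 ≤ tangent a T y := by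
  have := le_tangent (p := 0) ha hT hy (by positivity)
  simpa using this

lemma tangent_half_lt_one {a T : ℝ} (ha : 0 < a) (hT : T < 2 * a ^ 2 / (1 + a)) :
    tangent a T (1 / 2) < 1 := by
  rw [lt_div_iff₀ (by positivity)] at hT
  have h1 : tangent a T (1 / 2) = 1 - (2 * a ^ 2 - T * (1 / 2 + a)) / (2 * (1 / 2 + a) ^ 2) := by
    rw [tangent]
    field_simp
    ring
  have h2 : 0 < 2 * a ^ 2 - T * (1 / 2 + a) := by
    rcases le_or_gt T 0 with h | h
    · nlinarith [sq_pos_of_pos ha]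
    · nlinarith
  have : 0 < (2 * a ^ 2 - T * (1 / 2 + a)) / (2 * (1 / 2 + a) ^ 2) := by positivity
  linarith

/-- `tangent` is affine in y, and y has mean 1/2 because the cosine of the angle difference has mean
zero. -/
lemma lintegral_tangent_sqChord {a T : ℝ} (ha : 0 < a) (hT : 0 ≤ T) :
    ∫⁻ p, ENNReal.ofReal (tangent a T (sqChord p)) ∂(uniformAngle.prod uniformAngle)
      = ENNReal.ofReal (tangent a T (1 / 2)) := by
  set d := 2 * a ^ 2 / (1 / 2 + a) ^ 3 + T * a / (1 / 2 + a) ^ 2 with hd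
  have h1 (p : ℝ × ℝ) : tangent a T (sqChord p)
      = tangent a T (1 / 2) + -(d / 2) * Real.cos (p.1 - p.2) := by
    rw [tangent, tangent, sqChord, ← hd]
    ring
  have hi : Integrable (fun p : ℝ × ℝ => Real.cos (p.1 - p.2))
      (uniformAngle.prod uniformAngle) :=
    Integrable.of_bound (by fun_prop) 1 (.of_forall fun p => Real.abs_cos_le_one _)
  have hi' : Integrable (fun p => tangent a T (sqChord p)) (uniformAngle.prod uniformAngle) := by
    simp_rw [h1]
    exact (integrable_const _).add (hi.const_mul _)
  rw [← ofReal_integral_eq_lintegral_ofReal hi'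
    (.of_forall fun p => tangent_nonneg ha hT (sqChord_nonneg p))]
  simp_rw [h1]
  rw [integral_add (integrable_const _) (hi.const_mul _), integral_const_mul,
    integral_cos_sub_uniformAngle]
  simp

/-- With p = 1 / (1 + u) the left side is (2 + T) p - p², since u / (1 + u)² = p (1 - p). The
infinite case is coincident UL and DL nodes, where p = 0. -/
lemma intra_factor_le {a T y : ℝ} (ha : 0 < a) (hT : 0 ≤ T) (hy : 0 ≤ y) {u : ENNReal}
    (hu : ENNReal.ofReal a / ENNReal.ofReal y ≤ u) :
    (1 + u)⁻¹ + (∫⁻ e, u * e * expNeg (u * e) ∂gainLaw) + (1 + u)⁻¹ * ENNReal.ofReal T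
      ≤ ENNReal.ofReal (tangent a T y) := by
  induction u with
  | top =>
    have h0 : ∫⁻ e, ⊤ * e * expNeg (⊤ * e) ∂gainLaw = 0 := by
      refine lintegral_eq_zero_of_ae_eq_zero ?_
      have h : ∀ᵐ e ∂gainLaw, e ≠ 0 := by
        rw [ae_iff]; simpa using gainLaw_singleton_zero
      filter_upwards [h] with e he
      simp [ENNReal.top_mul he, expNeg_top]
    simp [h0]
  | coe v =>
    have hv := v.coe_nonneg
    rw [← ENNReal.ofReal_coe_nnreal] at hu ⊢
    rcases hy.eq_or_lt with rfl | hy0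
    · rw [ENNReal.ofReal_zero, ENNReal.div_zero (by simpa using ha)] at hu
      exact absurd (top_le_iff.1 hu) ENNReal.ofReal_ne_top
    rw [← ENNReal.ofReal_div_of_pos hy0, ENNReal.ofReal_le_ofReal_iff hv] at hu
    rw [lintegral_mul_expNeg_mul_gainLaw hv, ← ENNReal.ofReal_one,
      ← ENNReal.ofReal_add zero_le_one hv, ← ENNReal.ofReal_inv_of_pos (by positivity),
      ← ENNReal.ofReal_mul (by positivity), ← ENNReal.ofReal_add (by positivity) (by positivity),
      ← ENNReal.ofReal_add (by positivity) (by positivity)]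
    refine ENNReal.ofReal_le_ofReal ?_
    have hp : (1 + (v : ℝ))⁻¹ ≤ y / (y + a) := by
      rw [inv_le_comm₀ (by positivity) (by positivity), inv_div, add_div, div_self hy0.ne']
      linarith
    refine le_trans (le_of_eq ?_) (le_tangent ha hT hy hp)
    field_simp
    ring

/-! ### The threshold -/

lemma intraConst_eq {α rhoU rhoB R θ : ℝ} (hR : 0 < R) :
    θ / (rhoB * R ^ (-α)) * rhoU * (2 * R) ^ (-α) = 2 ^ (-α) * θ * rhoU * rhoB⁻¹ := by
  have := Real.rpow_pos_of_pos hR (-α)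
  rw [Real.mul_rpow (by norm_num) hR.le]
  field_simp

/-- T scales as λR², and squaring the assumption gives λR² ≤ Δ(θ)². Substitution leaves the claimed
bound times α / (α + 2), a strict slack. -/
lemma interConst_lt {lam α rhoU rhoB R θ : ℝ} (hlam : 0 < lam) (hα : 2 < α) (hU : 0 < rhoU)
    (hB : 0 < rhoB) (hR : 0 < R) (hθ : 0 < θ)
    (hle : R ≤ delta α rhoU rhoB θ / Real.sqrt lam) :
    lam * (spatialConst α (θ / (rhoB * R ^ (-α)) * rhoB)
        + spatialConst α (θ / (rhoB * R ^ (-α)) * rhoU))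
      < 2 * (2 ^ (-α) * θ * rhoU * rhoB⁻¹) ^ 2 / (1 + 2 ^ (-α) * θ * rhoU * rhoB⁻¹) := by
  have hα0 : 0 < α := by linarith
  have hsin := sin_two_pi_div_pos hα
  set a := (2 : ℝ) ^ (-α) * θ * rhoU * rhoB⁻¹ with ha
  have ha0 : 0 < a := by positivity
  set Y := upsilonMin α rhoU rhoB 1 with hY
  have hYeq : Y = (1 + 2 / α) * (rhoU ^ (2 / α) + rhoB ^ (2 / α)) *
      (Real.pi ^ 2 / (α * Real.sin (2 * Real.pi / α))) := by
    rw [hY, upsilonMin, Real.one_rpow, mul_one]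
  have hY0 : 0 < Y := by
    rw [hYeq]
    positivity
  have hτ : (θ / (rhoB * R ^ (-α))) ^ (2 / α) = (θ / rhoB) ^ (2 / α) * R ^ 2 := by
    rw [Real.rpow_neg hR.le, show θ / (rhoB * (R ^ α)⁻¹) = θ / rhoB * R ^ α by field_simp,
      Real.mul_rpow (by positivity) (by positivity), ← Real.rpow_mul hR.le,
      mul_div_cancel₀ _ hα0.ne', Real.rpow_two]
  have hT : lam * (spatialConst α (θ / (rhoB * R ^ (-α)) * rhoB)
        + spatialConst α (θ / (rhoB * R ^ (-α)) * rhoU))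
      = lam * R ^ 2 * ((θ / rhoB) ^ (2 / α) * Y * (4 / (α + 2))) := by
    rw [spatialConst, spatialConst, Real.mul_rpow (by positivity) hB.le,
      Real.mul_rpow (by positivity) hU.le, hτ, hYeq]
    field_simp
    ring
  have hsq : lam * R ^ 2 ≤ delta α rhoU rhoB θ ^ 2 := by
    rw [le_div_iff₀ (by positivity)] at hle
    have h1 := pow_le_pow_left₀ (by positivity) hle 2
    rw [mul_pow, Real.sq_sqrt hlam.le] at h1
    linarith
  have hΔ : delta α rhoU rhoB θ ^ 2
      = a ^ 2 * ((θ / rhoB) ^ (2 / α))⁻¹ * (α / (2 * Y * (a + 1))) := by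
    have e1 : (θ ^ (1 - 1 / α)) ^ 2 = θ ^ 2 * (θ ^ (2 / α))⁻¹ := by
      rw [← Real.rpow_natCast, ← Real.rpow_mul hθ.le, ← Real.rpow_neg hθ.le, ← Real.rpow_natCast,
        ← Real.rpow_add hθ]
      congr 1
      push_cast
      ring
    have e2 : (rhoB ^ (1 / α - 1)) ^ 2 = (rhoB⁻¹) ^ 2 * rhoB ^ (2 / α) := by
      rw [← Real.rpow_natCast, ← Real.rpow_mul hB.le, ← Real.rpow_neg_one, ← Real.rpow_natCast,
        ← Real.rpow_mul hB.le, ← Real.rpow_add hB]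
      congr 1
      push_cast
      ring
    have e3 : (2 : ℝ) ^ (-(2 * α + 1)) = ((2 : ℝ) ^ (-α)) ^ 2 / 2 := by
      rw [← Real.rpow_natCast, ← Real.rpow_mul (by norm_num),
        show -(2 * α + 1) = -α * ((2 : ℕ) : ℝ) - 1 by push_cast; ring,
        Real.rpow_sub_one (by norm_num)]
    rw [delta, mul_pow, mul_pow, mul_pow, Real.sq_sqrt (by positivity), e1, e2, e3, ← ha, ← hY,
      Real.div_rpow hθ.le hB.le]
    have h1 := Real.rpow_pos_of_pos hθ (2 / α)
    have h2 := Real.rpow_pos_of_pos hB (2 / α)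
    have h3 : a ^ 2 = ((2 : ℝ) ^ (-α)) ^ 2 * θ ^ 2 * rhoU ^ 2 * (rhoB⁻¹) ^ 2 := by
      rw [ha]; ring
    rw [h3]
    field_simp
  have hp : 0 < (θ / rhoB) ^ (2 / α) := by positivity
  calc _ = lam * R ^ 2 * ((θ / rhoB) ^ (2 / α) * Y * (4 / (α + 2))) := hT
    _ ≤ delta α rhoU rhoB θ ^ 2 * ((θ / rhoB) ^ (2 / α) * Y * (4 / (α + 2))) := by gcongr
    _ = 2 * a ^ 2 / (1 + a) * (α / (α + 2)) := by
        rw [hΔ]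
        field_simp
        ring
    _ < 2 * a ^ 2 / (1 + a) * 1 := by
        gcongr
        rw [div_lt_one (by linarith)]
        linarith
    _ = _ := mul_one _

/-! ### Comparison of the success probabilities -/

lemma lintegral_gainLaw_mrc (i u : ENNReal) :
    ∫⁻ e, (1 + (i + u * e)) * expNeg (i + u * e) ∂gainLaw
      = expNeg i * ((1 + u)⁻¹ + ∫⁻ e, u * e * expNeg (u * e) ∂gainLaw)
        + i * expNeg i * (1 + u)⁻¹ := by
  have h1 (e : ENNReal) : (1 + (i + u * e)) * expNeg (i + u * e)
      = expNeg i * (expNeg (u * e) + u * e * expNeg (u * e)) + i * expNeg i * expNeg (u * e) := by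
    rw [expNeg_add]
    ring
  simp_rw [h1]
  rw [lintegral_add_left (by fun_prop), lintegral_const_mul _ (by fun_prop),
    lintegral_const_mul _ (by fun_prop), lintegral_add_left (by fun_prop),
    lintegral_expNeg_mul_gainLaw]

end FDNetwork

theorem corollary8 {Ω : Type*} [MeasurableSpace Ω] (P : Measure Ω) [IsProbabilityMeasure P]
    (X : ℕ → Ω → FDNetwork.Plane) (mark : Option ℕ → Ω → FDNetwork.CellMark)
    (lam α rhoU rhoB R θ : ℝ) (hlam : 0 < lam) (hα : 2 < α) (hrhoU : 0 < rhoU)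
    (hrhoB : 0 < rhoB) (hR : 0 < R) (hθ : 0 < θ)
    (hnet : FDNetwork.IsNetwork P lam X mark)
    (hle : R ≤ FDNetwork.delta α rhoU rhoB θ / Real.sqrt lam) :
    FDNetwork.successMRC P X mark α rhoU rhoB R R θ <
      FDNetwork.successPZF P X mark α rhoU rhoB R R θ := by
  open FDNetwork in
  have hτ : 0 < θ / (rhoB * R ^ (-α)) := by positivity
  have hlt := interConst_lt hlam hα hrhoU hrhoB hR hθ hle
  have ha := intraConst_eq (α := α) (rhoU := rhoU) (rhoB := rhoB) (θ := θ) hR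
  rw [← ha] at hlt
  have hmrc := hnet.success_eq (α := α) (rhoU := rhoU) hrhoB hR hθ
    (W := fun c => mrc c.1) (measurable_mrc.comp measurable_fst) ae_norm_mrc
  have hpzf := hnet.success_eq (α := α) (rhoU := rhoU) hrhoB hR hθ
    (W := fun c => pzf c.2 c.1) measurable_pzf ae_norm_pzf
  simp only [rayleigh_prod_mrc] at hmrc
  -- Brings the argument into the form i + u e, with i = τI and u the scaled intra-cell power.
  simp only [mul_add, ← mul_assoc] at hmrc
  simp only [lintegral_gainLaw_mrc] at hmrc
  simp only [rayleigh_prod_pzf, lintegral_expNeg_interCell hnet.poisson, lintegral_const,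
    measure_univ, mul_one] at hpzf
  set τ := θ / (rhoB * R ^ (-α))
  set a := τ * rhoU * (2 * R) ^ (-α)
  have ha0 : 0 < a := by positivity
  have hT0 : 0 ≤ lam * (spatialConst α (τ * rhoB) + spatialConst α (τ * rhoU)) :=
    mul_nonneg hlam.le (add_nonneg (spatialConst_nonneg hα (by positivity))
      (spatialConst_nonneg hα (by positivity)))
  have hM := lintegral_mul_expNeg_interCell_le hnet.poisson R hα hlam hrhoU hrhoB hτ
  set T := lam * (spatialConst α (τ * rhoB) + spatialConst α (τ * rhoU))
  have hL0 := expNeg_ne_zero (interExponent_ne_top (lam := lam) (R := R) hα hrhoU hrhoB hτ)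
  have hL := lintegral_expNeg_interCell hnet.poisson α rhoU rhoB R (ENNReal.ofReal τ)
  set L := expNeg (interExponent lam α rhoU rhoB R (ENNReal.ofReal τ))
  have hbound (p : ℝ × ℝ) : _ ≤ L * ENNReal.ofReal (tangent a T (sqChord p)) :=
    calc ∫⁻ x, ∫⁻ k, (expNeg (ENNReal.ofReal τ * interCell α rhoU rhoB R (dlNode R p) x k) *
            ((1 + ENNReal.ofReal τ * intraPower α rhoU R p)⁻¹ +
              ∫⁻ e, ENNReal.ofReal τ * intraPower α rhoU R p * e *
                expNeg (ENNReal.ofReal τ * intraPower α rhoU R p * e) ∂gainLaw) +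
          ENNReal.ofReal τ * interCell α rhoU rhoB R (dlNode R p) x k *
            expNeg (ENNReal.ofReal τ * interCell α rhoU rhoB R (dlNode R p) x k) *
            (1 + ENNReal.ofReal τ * intraPower α rhoU R p)⁻¹)
            ∂(Measure.infinitePi fun _ : ℕ => cellGainLaw) ∂(P.map fun ω i => X i ω)
        = L * ((1 + ENNReal.ofReal τ * intraPower α rhoU R p)⁻¹ +
              ∫⁻ e, ENNReal.ofReal τ * intraPower α rhoU R p * e *
                expNeg (ENNReal.ofReal τ * intraPower α rhoU R p * e) ∂gainLaw)
          + (∫⁻ x, ∫⁻ k, ENNReal.ofReal τ * interCell α rhoU rhoB R (dlNode R p) x k *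
            expNeg (ENNReal.ofReal τ * interCell α rhoU rhoB R (dlNode R p) x k)
            ∂(Measure.infinitePi fun _ : ℕ => cellGainLaw) ∂(P.map fun ω i => X i ω)) *
            (1 + ENNReal.ofReal τ * intraPower α rhoU R p)⁻¹ := by
          rw [← hL (dlNode R p), ← lintegral_mul_const _ (Measurable.lintegral_prod_right
            (by fun_prop)), ← lintegral_mul_const _ (Measurable.lintegral_prod_right
            (by fun_prop)), ← lintegral_add_left (Measurable.mul_const
            (Measurable.lintegral_prod_right (by fun_prop)) _)]
          refine lintegral_congr fun x => ?_
          rw [lintegral_add_left (by fun_prop), lintegral_mul_const _ (by fun_prop),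
            lintegral_mul_const _ (by fun_prop)]
      _ ≤ L * ((1 + ENNReal.ofReal τ * intraPower α rhoU R p)⁻¹ +
              ∫⁻ e, ENNReal.ofReal τ * intraPower α rhoU R p * e *
                expNeg (ENNReal.ofReal τ * intraPower α rhoU R p * e) ∂gainLaw)
          + L * ENNReal.ofReal T * (1 + ENNReal.ofReal τ * intraPower α rhoU R p)⁻¹ := by
          gcongr
          exact hM _
      _ = L * ((1 + ENNReal.ofReal τ * intraPower α rhoU R p)⁻¹ +
              (∫⁻ e, ENNReal.ofReal τ * intraPower α rhoU R p * e *
                expNeg (ENNReal.ofReal τ * intraPower α rhoU R p * e) ∂gainLaw)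
              + (1 + ENNReal.ofReal τ * intraPower α rhoU R p)⁻¹ * ENNReal.ofReal T) := by
          ring
      _ ≤ L * ENNReal.ofReal (tangent a T (sqChord p)) := by
          gcongr
          exact intra_factor_le ha0 hT0 (sqChord_nonneg p)
            (div_sqChord_le_intraPower hα hrhoU hR hτ p)
  calc successMRC P X mark α rhoU rhoB R R θ
      ≤ ∫⁻ p, L * ENNReal.ofReal (tangent a T (sqChord p)) ∂(uniformAngle.prod uniformAngle) :=
        hmrc.le.trans (lintegral_mono hbound)
    _ = L * ENNReal.ofReal (tangent a T (1 / 2)) := by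
        rw [lintegral_const_mul' _ _ (expNeg_ne_top _), lintegral_tangent_sqChord ha0 hT0]
    -- The only strict step: it needs L nonzero and finite.
    _ < L * 1 := by
        refine (ENNReal.mul_lt_mul_iff_right hL0 (expNeg_ne_top _)).2 ?_
        rw [ENNReal.ofReal_lt_one]
        exact tangent_half_lt_one ha0 hlt
    _ = successPZF P X mark α rhoU rhoB R R θ := by
        rw [mul_one]
        exact hpzf.symm
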